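/- Let $k\ge 1$, $a\neq0$ and let $f(x)=x+ax^{k+1}+O(x^{k+2})$ be holomorphic on a disc $D$ centered at $0$. Put $t(x)=-\frac1{ak}x^{-k}$. Let $W\subset D\setminus\{0\}$ be an attracting petal: a connected open set with $f(W)\subset W$ on which $t(x)\notin\mathbb R_{\le0}$, carrying a sectorial Fatou coordinate $\psi_{\mathbb A}$, i.e. an injective holomorphic function with $\psi_{\mathbb A}\circ f=\psi_{\mathbb A}+1$ such that $\psi_{\mathbb A}(x)-\big(t(x)+\sum_{j=1}^{k-1}r_jx^{-j}-\frac{\rho}{k}\log t(x)\big)$ is bounded on $W$ for some constants $r_1,\dots,r_{k-1},\rho\in\mathbb C$. Let $x_0\in W$, $\psi_{\mathbb A}(x_0)=0$, and let $\mathbb A=\{x_n=f^{\circ n}(x_0):n\ge0\}$. Let $\alpha\in\,]\frac\pi2,\frac{3\pi}2[$ mod $2\pi\mathbb Z$, and suppose that $\psi_{\mathbb A}(W)$ contains a half-plane $\{\tau:\operatorname{Re}(e^{i\alpha}\tau)<A\}$ with $A>0$. Fix $C\in\mathbb C$ with $0<\operatorname{Re}(e^{i\alpha}C)<A$. On this half-plane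 let $u(\tau)=t(\psi_{\mathbb A}^{-1}(\tau))-\tau$ (this is $u=t\circ\psi_{\mathbb A}^{-1}\circ t-t$ written in the variable $\tau=t(x)$). Then: (1) For every $\sigma\in\mathbb C$ the major Borel transform $$\tilde Q(\xi,\sigma)=\frac1{2\pi i}\int_{C+e^{-i\beta}\mathbb R_{\ge0}}e^{-\sigma u(\tau)}e^{-\xi\tau}\,d\tau ,\qquad \beta\in\,]\alpha+\tfrac\pi2,\alpha+\tfrac{3\pi}2[,\quad \operatorname{Re}(e^{-i\beta}\xi)>0,$$ converges absolutely and does not depend on $\beta$; it is thus defined for all $\xi\in\mathbb C\setminus e^{i\alpha}\mathbb R_{\ge0}$. (2) The series $\Theta_{\mathbb A}(s)=\sum_{n\ge0}e^{-s\,t(x_n)}$ converges absolutely for $\operatorname{Re}s>0$, and $\Theta_{\mathbb A}$ extends holomorphically to $\mathbb C\setminus\bigcup_{\omega\in2\pi i\mathbb Z}(\omega+e^{i\alpha}\mathbb R_{\ge0})$. (3) For every $s$ in this slit plane, $$\Theta_{\mathbb A}(s)=\int_{\mathrm{Circ}(e^{i\alpha}\mathbb R_{\ge0})}\frac{\tilde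 Q(\xi,s)}{1-e^{\xi-s}}\,d\xi=\int_{e^{i\alpha}\mathbb R_{\ge0}}\frac{Q(\xi,s)}{1-e^{\xi-s}}\,d\xi .$$ Here $\mathrm{Circ}(e^{i\alpha}\mathbb R_{\ge0})$ is the positively oriented Hankel contour which bounds $\{e^{i\alpha}(x+iy):x>-\delta,\ |y|<\varepsilon\}$; the first integral converges absolutely and the equality holds for all sufficiently small $\delta,\varepsilon>0$ (depending on $s$). In the second integral $Q(\cdot,s)$ is the distributional boundary value $\tilde Q(\xi-ie^{i\alpha}0^+,s)-\tilde Q(\xi+ie^{i\alpha}0^+,s)$: for every sufficiently small $\delta>0$ the integral is the limit, as $\varepsilon\to0^+$, of $\int g(x-i\varepsilon)\,e^{i\alpha}dx-\int g(x+i\varepsilon)\,e^{i\alpha}dx$ over $x\in\,]-\delta,\infty[$, where $g(z)=\tilde Q(e^{i\alpha}z,s)/(1-e^{e^{i\alpha}z-s})$. -/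

import Mathlib

open Complex Set Filter Topology MeasureTheory

noncomputable section

/-- The Fatou coordinate `t(x) = -1/(a k) * x^(-k)` of the model field `a x^(k+1) d/dx`. -/
def modelFatou (a : ℂ) (k : ℕ) (x : ℂ) : ℂ := -1 / (a * k * x ^ k)

/-- `f` represents, on the disc of radius `R`, a parabolic germ
`f(x) = x + a x^(k+1) + h.o.t.` with `a ≠ 0` and `k ≥ 1`. -/
structure IsParabolicGerm (f : ℂ → ℂ) (a : ℂ) (k : ℕ) (R : ℝ) : Prop where
  a_ne : a ≠ 0
  k_pos : 1 ≤ k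
  R_pos : 0 < R
  holo : DifferentiableOn ℂ f (Metric.ball 0 R)
  expansion : (fun x : ℂ => f x - x - a * x ^ (k + 1)) =O[𝓝 0] fun x : ℂ => x ^ (k + 2)

/-- `ψ` is a sectorial Fatou coordinate of `f` on the attracting petal `W`: `W` is a connected open
forward invariant subset of the disc, on which `arg t(x)` stays in `(-π, π)`; on `W`, `ψ` is
holomorphic, injective, satisfies the Abel equation `ψ ∘ f = ψ + 1`, and differs by a bounded
function from a principal part `t(x) + ∑_{0<j<k} r_j x^(-j) - (ρ/k) log t(x)`. Up to a constant,
`-(ρ/k) log t(x)` is `ρ log x`. (The numbers `r_j`, `ρ` are then determined by `f`; when `f` is in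
prenormalized form all the `r_j` vanish.) -/
structure IsSectorialFatou (f : ℂ → ℂ) (a : ℂ) (k : ℕ) (R : ℝ) (W : Set ℂ) (ψ : ℂ → ℂ) :
    Prop where
  isOpen : IsOpen W
  isConnected : IsConnected W
  subset_ball : W ⊆ Metric.ball 0 R
  arg_lt : ∀ x ∈ W, modelFatou a k x ∈ slitPlane
  mapsTo : MapsTo f W W
  holo : DifferentiableOn ℂ ψ W
  injOn : InjOn ψ W
  abel : ∀ x ∈ W, ψ (f x) = ψ x + 1
  asymptotic : ∃ (r : ℕ → ℂ) (ρ : ℂ) (M : ℝ), ∀ x ∈ W,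
    ‖ψ x - (modelFatou a k x + ∑ j ∈ Finset.Ico 1 k, r j / x ^ j
      - ρ / k * Complex.log (modelFatou a k x))‖ ≤ M

/-- The function `u = t ∘ ψ⁻¹ ∘ t - t`, written in the coordinate `τ = t(x)`. It is meaningful for
`τ ∈ ψ(W)`, where `ψ⁻¹ : ψ(W) → W` is the inverse of the injective map `ψ`. -/
def uFun (a : ℂ) (k : ℕ) (W : Set ℂ) (ψ : ℂ → ℂ) (τ : ℂ) : ℂ :=
  modelFatou a k (Function.invFunOn ψ W τ) - τ

/-- The open half-plane `{τ | Re (e^{iα} τ) < A}`. -/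
def borelHalfPlane (α A : ℝ) : Set ℂ := {τ : ℂ | (exp (I * α) * τ).re < A}

/-- `H` is the major Borel transform, in the direction `α` and with base point `C`, of the function
`h` (of the variable `t`): for every `β ∈ (α + π/2, α + 3π/2)`,
`H(ξ) = (1/2πi) ∫_{C + e^{-iβ} ℝ≥0} h(t) e^{-ξt} dt` (an absolutely convergent integral) on the
half-plane `Re (e^{-iβ} ξ) > 0`. These half-planes cover exactly `ℂ ∖ e^{iα} ℝ≥0`,
so that `H` is determined on this set. -/
def IsMajorBorel (α : ℝ) (C : ℂ) (h H : ℂ → ℂ) : Prop :=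
  ∀ β ∈ Ioo (α + Real.pi / 2) (α + 3 * Real.pi / 2), ∀ ξ : ℂ, 0 < (exp (-(I * β)) * ξ).re →
    IntegrableOn (fun r : ℝ => h (C + exp (-(I * β)) * r) *
        exp (-(ξ * (C + exp (-(I * β)) * r))) * exp (-(I * β))) (Ioi 0) ∧
    H ξ = 1 / (2 * Real.pi * I) *
      ∫ r : ℝ in Ioi 0, h (C + exp (-(I * β)) * r) *
        exp (-(ξ * (C + exp (-(I * β)) * r))) * exp (-(I * β))

/-- The plane slit along the rays `ω + e^{iα} ℝ≥0`, `ω ∈ 2πi ℤ`. -/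
def thetaSlitPlane (α : ℝ) : Set ℂ :=
  {s : ℂ | ∀ (n : ℤ) (r : ℝ), 0 ≤ r → s ≠ 2 * Real.pi * I * n + exp (I * α) * r}

/-- `Θ` is the dynamic theta function of the forward orbit of `x₀`, continued to the plane slit in
the direction `α`: it is holomorphic there, and equals `∑_n e^{-s t(f^n(x₀))}` for `Re s > 0`. -/
structure IsDynamicTheta (f : ℂ → ℂ) (a : ℂ) (k : ℕ) (x₀ : ℂ) (α : ℝ) (Θ : ℂ → ℂ) : Prop where
  holo : DifferentiableOn ℂ Θ (thetaSlitPlane α)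
  hasSum : ∀ s : ℂ, 0 < s.re →
    HasSum (fun n : ℕ => exp (-(s * modelFatou a k (f^[n] x₀)))) (Θ s)

/-- Absolute convergence of the integral of `F` over the Hankel contour around `e^{iα} ℝ≥0` which
bounds the half-strip `{e^{iα} (x + i y) | x > -δ, |y| < ε}`. -/
def HankelIntegrable (α δ ε : ℝ) (F : ℂ → ℂ) : Prop :=
  IntegrableOn (fun x : ℝ => F (exp (I * α) * (x + I * ε))) (Ioi (-δ)) ∧
  IntervalIntegrable (fun y : ℝ => F (exp (I * α) * (-δ + I * y))) volume (-ε) ε ∧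
  IntegrableOn (fun x : ℝ => F (exp (I * α) * (x - I * ε))) (Ioi (-δ))

/-- The integral of `F` over the positively oriented Hankel contour around `e^{iα} ℝ≥0` which
bounds the half-strip `{e^{iα} (x + i y) | x > -δ, |y| < ε}`: it comes in from infinity on the side
`y = ε`, crosses behind the origin from `y = ε` to `y = -ε`, and goes out to infinity on the side
`y = -ε`. -/
def hankelIntegral (α δ ε : ℝ) (F : ℂ → ℂ) : ℂ :=
  -(∫ x : ℝ in Ioi (-δ), F (exp (I * α) * (x + I * ε)) * exp (I * α)) +
  (∫ y : ℝ in ε..(-ε), F (exp (I * α) * (-δ + I * y)) * (exp (I * α) * I)) +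
  ∫ x : ℝ in Ioi (-δ), F (exp (I * α) * (x - I * ε)) * exp (I * α)

/-- The integral over the ray `e^{iα} ℝ≥0` of `G` against the boundary value
`BV[H] = H(ξ - i e^{iα} 0+) - H(ξ + i e^{iα} 0+)`, as a distributional limit, is `J`. Here `G` is
holomorphic near the ray and `H` is holomorphic off the ray, so that `BV[H]` vanishes just
behind the origin; the integration starts at `-δ e^{iα}` in order to
account for the part of the distribution that sits at the origin. -/
def HasBVIntegral (α δ : ℝ) (G H : ℂ → ℂ) (J : ℂ) : Prop :=
  Tendsto (fun ε : ℝ =>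
    (∫ x : ℝ in Ioi (-δ),
      G (exp (I * α) * (x - I * ε)) * H (exp (I * α) * (x - I * ε)) * exp (I * α)) -
    ∫ x : ℝ in Ioi (-δ),
      G (exp (I * α) * (x + I * ε)) * H (exp (I * α) * (x + I * ε)) * exp (I * α))
    (𝓝[>] 0) (𝓝 J)

end

/-! Let `P` be the half-plane and `h = e^{-su}`. The Fatou coordinate differs from `t(x)` by powers
of `1/x` of degree below `k`, a logarithm and a bounded term, all of which are `o(t)` up to
constants. Hence `u` is sublinear on `P` (`isSublinearOn_uFun`) and `h` grows more slowly than any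
exponential. Its Laplace integrals therefore converge along every ray staying in `P`, and Cauchy's
theorem (`rayLaplace_eq_rayLaplace`) glues them to one function `majorBorel` off the ray `e^{iα}
ℝ≥0`. Since `Re (e^{iα} C) > 0`, this function decays exponentially along the ray at each fixed
distance from it.

The heart is the inversion formula `hankelIntegral_majorBorel_mul_exp`: the Hankel integral of the
transform of `h` against `e^{ξw}` is `h(w)`. Write `h = h(w) + (τ - w) g` with `g` the divided
slope. Multiplication by `τ` becomes `-d/dξ` on the Borel side, so the second term contributes the
integral of an exact derivative whose primitive decays at both ends, which is zero. The constant
contributes a multiple of the Hankel integral of `e^{-κξ}/ξ`, which is the jump `2πi` of the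
logarithm. No double integral is exchanged.

The Abel equation gives `t(x_n) = n + u(n)` (`modelFatou_iterate`). Taking `w = n`, multiplying by
`e^{-sn}` and summing the geometric series in `e^{ξ-s}` turns the theta series into the Hankel
integral with kernel `1/(1 - e^{ξ-s})` when `Re s > 0` (`hasSum_hankelTheta`). The right side makes
sense as long as no pole `ξ ∈ s + 2πi ℤ` lies on the ray, that is, for every `s` in the slit plane,
and there it is holomorphic in `s` (`differentiableOn_hankelTheta`): this is the continuation.
Letting the contour shrink onto the ray kills the short transverse side and leaves the boundary
value integral (`hasBVIntegral_hankelTheta`). -/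

/-! ### Complex analysis: integrals with a parameter, primitives, inverse functions. -/

/-- A dominated integral of holomorphic functions is holomorphic. -/
theorem differentiableOn_integral_of_dominated {X : Type*} [MeasurableSpace X] {μ : Measure X}
    {U : Set ℂ} (hU : IsOpen U) {F : ℂ → X → ℂ} {bound : X → ℝ}
    (hmeas : ∀ z ∈ U, AEStronglyMeasurable (F z) μ)
    (hdiff : ∀ᵐ x ∂μ, DifferentiableOn ℂ (fun z => F z x) U)
    (hbound : ∀ᵐ x ∂μ, ∀ z ∈ U, ‖F z x‖ ≤ bound x) (hint : Integrable bound μ) :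
    DifferentiableOn ℂ (fun z => ∫ x, F z x ∂μ) U := by
  intro z₀ hz₀
  obtain ⟨r, hr, hrU⟩ := Metric.isOpen_iff.1 hU z₀ hz₀
  have hsub : ∀ z ∈ Metric.ball z₀ (r / 2), Metric.closedBall z (r / 4) ⊆ U := by
    intro z hz w hw
    apply hrU
    rw [Metric.mem_ball] at hz ⊢
    rw [Metric.mem_closedBall] at hw
    linarith [dist_triangle w z z₀]
  have key := hasDerivAt_integral_of_dominated_loc_of_deriv_le (μ := μ) (F := F)
    (F' := fun z x => deriv (fun w => F w x) z) (bound := fun x => bound x / (r / 4))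
    (Metric.ball_mem_nhds z₀ (half_pos hr))
    (by filter_upwards [hU.mem_nhds hz₀] with z hz using hmeas z hz)
    (Integrable.mono' hint (hmeas z₀ hz₀) (hbound.mono fun x hx => hx z₀ hz₀)) ?_ ?_
    (hint.div_const _) ?_
  · exact key.2.differentiableAt.differentiableWithinAt
  -- The derivative in the parameter is measurable in `x` as a pointwise limit of difference
  -- quotients along a sequence tending to `z₀`.
  · let w : ℕ → ℂ := fun n => z₀ + ((r / 2 * (1 / ((n : ℝ) + 1)) : ℝ) : ℂ)
    have hw0 : Tendsto w atTop (𝓝 z₀) := by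
      have h1 : Tendsto (fun n : ℕ => r / 2 * (1 / ((n : ℝ) + 1))) atTop (𝓝 (r / 2 * 0)) :=
        tendsto_one_div_add_atTop_nhds_zero_nat.const_mul _
      have h2 := (Complex.continuous_ofReal.tendsto _).comp h1
      simpa [w] using h2.const_add z₀
    have hwne : ∀ n, w n ≠ z₀ := by
      intro n h
      have : ((r / 2 * (1 / ((n : ℝ) + 1)) : ℝ) : ℂ) = 0 := by
        simpa [w] using h
      rw [Complex.ofReal_eq_zero] at this
      have : 0 < r / 2 * (1 / ((n : ℝ) + 1)) := by positivity
      linarith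
    have hwU : ∀ n, w n ∈ U := by
      intro n
      apply hrU
      rw [Metric.mem_ball, dist_eq_norm]
      have h1 : (1 / ((n : ℝ) + 1)) ≤ 1 := by
        rw [div_le_one (by positivity)]; linarith [(Nat.cast_nonneg n : (0 : ℝ) ≤ n)]
      have h0 : 0 < (1 / ((n : ℝ) + 1)) := by positivity
      simp only [w, add_sub_cancel_left, Complex.norm_real, Real.norm_eq_abs]
      rw [abs_of_pos (by positivity)]
      nlinarith
    refine aestronglyMeasurable_of_tendsto_ae atTop
      (f := fun n x => slope (fun z => F z x) z₀ (w n)) (fun n => ?_) ?_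
    · simp only [slope_def_field]
      simp only [div_eq_mul_inv]
      exact AEStronglyMeasurable.mul_const ((hmeas _ (hwU n)).sub (hmeas _ hz₀)) _
    · filter_upwards [hdiff] with x hx
      have := (hx.differentiableAt (hU.mem_nhds hz₀)).hasDerivAt
      rw [hasDerivAt_iff_tendsto_slope] at this
      exact this.comp (tendsto_nhdsWithin_iff.2 ⟨hw0, Eventually.of_forall hwne⟩)
  · filter_upwards [hdiff, hbound] with x hx hb z hz
    -- Cauchy's estimate on circles of radius `r / 4` turns the bound on `F` into a bound on its
    -- derivative, so no hypothesis on the derivative is needed.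
    refine Complex.norm_deriv_le_of_forall_mem_sphere_norm_le (by positivity) ?_ ?_
    · refine (hx.mono ?_).diffContOnCl
      exact (closure_minimal Metric.ball_subset_closedBall Metric.isClosed_closedBall).trans
        (hsub z hz)
    · intro w hw
      exact hb w (hsub z hz (Metric.sphere_subset_closedBall hw))
  · filter_upwards [hdiff] with x hx z hz
    exact (hx.differentiableAt (hU.mem_nhds
      (hsub z hz (Metric.mem_closedBall_self (by positivity))))).hasDerivAt

/-- A holomorphic function on a star-convex open set has a primitive. -/
theorem StarConvex.isExactOn {U : Set ℂ} (hU : IsOpen U) {p : ℂ} (hp : StarConvex ℝ p U)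
    {F : ℂ → ℂ} (hF : DifferentiableOn ℂ F U) : IsExactOn F U := by
  refine ⟨fun z => ∫ t in (0 : ℝ)..1, F (p + t * (z - p)) * (z - p), fun z₀ hz₀ => ?_⟩
  have hmem : ∀ z ∈ U, ∀ t ∈ Icc (0 : ℝ) 1, p + t * (z - p) ∈ U := by
    intro z hz t ht
    have := hp.add_smul_sub_mem hz ht.1 ht.2
    simpa using this
  have hdF : DifferentiableOn ℂ (deriv F) U := hF.deriv hU
  have hcpt : IsCompact ((fun t : ℝ => p + t * (z₀ - p)) '' Icc 0 1) :=
    isCompact_Icc.image (by fun_prop)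
  obtain ⟨r, hr, hrU⟩ := hcpt.exists_cthickening_subset_open hU
    (by rintro _ ⟨t, ht, rfl⟩; exact hmem z₀ hz₀ t ht)
  have hcc := hcpt.cthickening (r := r)
  obtain ⟨M₁, hM₁⟩ := hcc.exists_bound_of_continuousOn (hdF.continuousOn.mono hrU)
  obtain ⟨M₀, hM₀⟩ := hcc.exists_bound_of_continuousOn (hF.continuousOn.mono hrU)
  have hball : ∀ z ∈ Metric.ball z₀ r, ∀ t ∈ Icc (0 : ℝ) 1,
      p + t * (z - p) ∈ Metric.cthickening r ((fun t : ℝ => p + t * (z₀ - p)) '' Icc 0 1) := by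
    intro z hz t ht
    refine Metric.mem_cthickening_of_dist_le _ (p + t * (z₀ - p)) r _ ⟨t, ht, rfl⟩ ?_
    rw [Metric.mem_ball, dist_eq_norm] at hz
    rw [dist_eq_norm, show p + t * (z - p) - (p + t * (z₀ - p)) = t * (z - z₀) by ring, norm_mul,
      Complex.norm_real, Real.norm_eq_abs, abs_of_nonneg ht.1]
    nlinarith [ht.1, ht.2, norm_nonneg (z - z₀)]
  have hcont : ∀ G : ℂ → ℂ, ContinuousOn G U → ∀ z ∈ U,
      ContinuousOn (fun t : ℝ => G (p + t * (z - p))) (Icc 0 1) := by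
    intro G hG z hz
    exact hG.comp (by fun_prop) fun t ht => hmem z hz t ht
  have hderiv : ∀ z ∈ U, ∀ t ∈ Icc (0 : ℝ) 1, HasDerivAt F (deriv F (p + t * (z - p)))
      (p + t * (z - p)) := fun z hz t ht =>
    (hF.differentiableAt (hU.mem_nhds (hmem z hz t ht))).hasDerivAt
  have hballU : ∀ z ∈ Metric.ball z₀ r, z ∈ U := by
    intro z hz
    have := hrU (hball z hz 1 (by simp))
    simpa using this
  have key := intervalIntegral.hasDerivAt_integral_of_dominated_loc_of_deriv_le (μ := volume)
    (a := 0) (b := 1) (F := fun z t => F (p + t * (z - p)) * (z - p)) (x₀ := z₀)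
    (F' := fun z t => deriv F (p + t * (z - p)) * t * (z - p) + F (p + t * (z - p)))
    (bound := fun t => M₁ * (‖z₀ - p‖ + r) + M₀) (Metric.ball_mem_nhds z₀ hr) ?_ ?_ ?_ ?_ ?_ ?_
  · convert key.2 using 1
    -- The `z`-derivative of the integrand is itself the `t`-derivative of `t F(p + t (z - p))`, so
    -- its integral over `[0, 1]` is `F z`.
    have h2 : ∀ t ∈ uIcc (0 : ℝ) 1, HasDerivAt (fun t : ℝ => (t : ℂ) * F (p + t * (z₀ - p)))
        (deriv F (p + t * (z₀ - p)) * t * (z₀ - p) + F (p + t * (z₀ - p))) t := by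
      intro t ht
      rw [uIcc_of_le zero_le_one] at ht
      have h3 : HasDerivAt (fun t : ℝ => p + (t : ℂ) * (z₀ - p)) (1 * (z₀ - p)) t :=
        ((Complex.ofRealCLM.hasDerivAt (x := t)).mul_const (z₀ - p)).const_add p
      have h4 := (hderiv z₀ hz₀ t ht).comp t h3
      have h5 := (Complex.ofRealCLM.hasDerivAt (x := t)).mul h4
      refine h5.congr_deriv ?_
      simp
      ring
    rw [intervalIntegral.integral_eq_sub_of_hasDerivAt h2 key.1]
    simp
  · filter_upwards [hU.mem_nhds hz₀] with z hz
    rw [uIoc_of_le zero_le_one]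
    exact (((hcont F hF.continuousOn z hz).mul continuousOn_const).mono
      Ioc_subset_Icc_self).aestronglyMeasurable measurableSet_Ioc
  · apply ContinuousOn.intervalIntegrable
    rw [uIcc_of_le zero_le_one]
    exact (hcont F hF.continuousOn z₀ hz₀).mul continuousOn_const
  · rw [uIoc_of_le zero_le_one]
    refine ContinuousOn.aestronglyMeasurable (ContinuousOn.mono ?_ Ioc_subset_Icc_self)
      measurableSet_Ioc
    exact (((hcont _ hdF.continuousOn z₀ hz₀).mul (by fun_prop)).mul continuousOn_const).add
      (hcont F hF.continuousOn z₀ hz₀)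
  · refine Eventually.of_forall fun t ht z hz => ?_
    rw [uIoc_of_le zero_le_one] at ht
    have ht' := Ioc_subset_Icc_self ht
    have h1 := hM₁ _ (hball z hz t ht')
    have h0 := hM₀ _ (hball z hz t ht')
    refine (norm_add_le _ _).trans (add_le_add ?_ h0)
    rw [norm_mul, norm_mul, Complex.norm_real, Real.norm_eq_abs, abs_of_nonneg ht'.1]
    have h2 : ‖z - p‖ ≤ ‖z₀ - p‖ + r := by
      rw [Metric.mem_ball, dist_eq_norm] at hz
      calc ‖z - p‖ = ‖(z₀ - p) + (z - z₀)‖ := by congr 1; ring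
        _ ≤ _ := (norm_add_le _ _).trans (by linarith)
    have h3 : ‖deriv F (p + t * (z - p))‖ * t ≤ M₁ := by
      nlinarith [norm_nonneg (deriv F (p + t * (z - p))), ht'.2]
    exact mul_le_mul h3 h2 (norm_nonneg _) ((norm_nonneg _).trans h1)
  · exact intervalIntegrable_const
  · refine Eventually.of_forall fun t ht z hz => ?_
    rw [uIoc_of_le zero_le_one] at ht
    have ht' := Ioc_subset_Icc_self ht
    have h3 : HasDerivAt (fun z : ℂ => p + (t : ℂ) * (z - p)) (t * 1) z :=
      (((hasDerivAt_id z).sub_const p).const_mul (t : ℂ)).const_add p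
    have h4 := (hderiv z (hballU z hz) t ht').comp z h3
    have h5 := h4.mul ((hasDerivAt_id z).sub_const p)
    refine h5.congr_deriv ?_
    simp

/-- Punctured neighbourhoods in `ℂ` are nonempty, so local constancy would give two points with one
image. This rules out the degenerate branches of the open mapping dichotomy and of the isolated
zeros of the derivative. -/
theorem Set.InjOn.not_eventually_const_nhds {ψ : ℂ → ℂ} {U : Set ℂ} (hU : IsOpen U)
    (hinj : InjOn ψ U) {z : ℂ} (hz : z ∈ U) (c : ℂ) : ¬ ∀ᶠ w in 𝓝 z, ψ w = c := by
  intro h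
  have h1 : ∀ᶠ w in 𝓝[≠] z, False := by
    filter_upwards [nhdsWithin_le_nhds h, nhdsWithin_le_nhds (hU.mem_nhds hz),
      self_mem_nhdsWithin] with w hw hwU hne
    exact hne (hinj hwU hz (hw.trans h.self_of_nhds.symm))
  exact h1.exists.elim fun _ h => h

/-- The inverse of an injective holomorphic function is holomorphic. -/
theorem Set.InjOn.differentiableOn_invFunOn {ψ : ℂ → ℂ} {U : Set ℂ} (hU : IsOpen U)
    (hψ : DifferentiableOn ℂ ψ U) (hinj : InjOn ψ U) :
    DifferentiableOn ℂ (Function.invFunOn ψ U) (ψ '' U) := by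
  have han : ∀ z ∈ U, AnalyticAt ℂ ψ z := fun z hz => hψ.analyticAt (hU.mem_nhds hz)
  have hinv : ∀ z ∈ U, Function.invFunOn ψ U (ψ z) = z := fun z hz =>
    hinj.leftInvOn_invFunOn hz
  have hopen : ∀ z ∈ U, 𝓝 (ψ z) ≤ map ψ (𝓝 z) := fun z hz =>
    (han z hz).eventually_constant_or_nhds_le_map_nhds.resolve_left
      (hinj.not_eventually_const_nhds hU hz _)
  have hcont : ∀ z ∈ U, ContinuousAt (Function.invFunOn ψ U) (ψ z) := by
    intro z hz N hN
    rw [hinv z hz] at hN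
    refine hopen z hz ?_
    rw [mem_map]
    filter_upwards [hN, hU.mem_nhds hz] with w hw hwU
    simpa [hinv w hwU] using hw
  have himg : ∀ z ∈ U, ψ '' U ∈ 𝓝 (ψ z) := fun z hz =>
    hopen z hz (image_mem_map (hU.mem_nhds hz))
  rintro _ ⟨z, hz, rfl⟩
  -- Critical points of `ψ` are isolated. Away from them the inverse is differentiable by the
  -- inverse function rule, and at `ψ z` continuity makes the singularity removable, so it is not
  -- necessary to know beforehand that `deriv ψ z ≠ 0`.
  refine (analyticAt_of_differentiable_on_punctured_nhds_of_continuousAt ?_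
    (hcont z hz)).differentiableAt.differentiableWithinAt
  have hd : ∀ᶠ w in 𝓝[≠] z, deriv ψ w ≠ 0 := by
    refine ((han z hz).deriv.eventually_eq_zero_or_eventually_ne_zero).resolve_left fun h => ?_
    obtain ⟨r, hr, hball⟩ := Metric.mem_nhds_iff.1 (inter_mem h (hU.mem_nhds hz))
    refine hinj.not_eventually_const_nhds hU hz (ψ z) ?_
    filter_upwards [Metric.ball_mem_nhds z hr] with w hw
    refine (convex_ball z r).is_const_of_fderivWithin_eq_zero (𝕜 := ℂ)
      (hψ.mono fun y hy => (hball hy).2) (fun y hy => ?_) hw (Metric.mem_ball_self hr)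
    rw [fderivWithin_of_isOpen Metric.isOpen_ball hy]
    ext
    simpa using (hball hy).1
  rw [eventually_nhdsWithin_iff] at hd ⊢
  have h1 : ∀ᶠ w in 𝓝 (ψ z), Function.invFunOn ψ U w ∈ {y | y ∈ ({z}ᶜ : Set ℂ) → deriv ψ y ≠ 0} := by
    have := hcont z hz
    rw [ContinuousAt, hinv z hz] at this
    exact this hd
  filter_upwards [h1, himg z hz, eventually_eventually_nhds.2 (himg z hz)] with w hw hwU hwE hne
  obtain ⟨y, hy, rfl⟩ := hwU
  change Function.invFunOn ψ U (ψ y) ∈ ({z}ᶜ : Set ℂ) → _ at hw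
  rw [hinv y hy] at hw
  refine (HasDerivAt.of_local_left_inverse (f := ψ) (f' := deriv ψ y) (hcont y hy) ?_
    (hw fun h => hne (by rw [h]; rfl)) ?_).differentiableAt
  · rw [hinv y hy]; exact (hψ.differentiableAt (hU.mem_nhds hy)).hasDerivAt
  · filter_upwards [hwE] with v hv
    exact Function.invFunOn_eq hv

/-! ### Laplace integrals along rays in a half-plane. -/

/-- The Laplace integral of `h` along the ray `C + d ℝ≥0`. -/
noncomputable def rayLaplace (h : ℂ → ℂ) (C d ξ : ℂ) : ℂ :=
  ∫ r : ℝ in Ioi 0, h (C + d * r) * exp (-(ξ * (C + d * r))) * d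

/-- `h` grows on `P` more slowly than every exponential of `‖τ‖`. -/
def IsSubexpOn (P : Set ℂ) (h : ℂ → ℂ) : Prop :=
  ∀ ε > 0, ∃ K : ℝ, ∀ τ ∈ P, ‖h τ‖ ≤ K * Real.exp (ε * ‖τ‖)

/-- The unit directions along which rays stay in the half-planes `borelHalfPlane α A`. -/
def IsBorelDir (α : ℝ) (d : ℂ) : Prop := ‖d‖ = 1 ∧ (exp (I * α) * d).re ≤ 0

theorem norm_exp_I_mul (α : ℝ) : ‖exp (I * α)‖ = 1 := by
  rw [mul_comm]; exact Complex.norm_exp_ofReal_mul_I α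

theorem norm_exp_neg_I_mul (α : ℝ) : ‖exp (-(I * α))‖ = 1 := by
  rw [Complex.exp_neg, norm_inv, norm_exp_I_mul, inv_one]

theorem exp_I_mul_exp_neg (α : ℝ) : exp (I * α) * exp (-(I * α)) = 1 := by
  rw [← Complex.exp_add]; simp

theorem isOpen_borelHalfPlane (α A : ℝ) : IsOpen (borelHalfPlane α A) :=
  isOpen_lt (by fun_prop) continuous_const

theorem re_mul_combo (e x y : ℂ) (a b : ℝ) :
    (e * (a • x + b • y)).re = a * (e * x).re + b * (e * y).re := by
  simp; ring

theorem convex_borelHalfPlane (α A : ℝ) : Convex ℝ (borelHalfPlane α A) := by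
  intro x hx y hy a b ha hb hab
  change (_ : ℂ).re < A at hx hy ⊢
  rw [re_mul_combo]
  rcases ha.eq_or_lt with rfl | ha
  · have : b = 1 := by linarith
    subst this; simpa using hy
  · have : A = a * A + b * A := by rw [← add_mul, hab, one_mul]
    nlinarith

section

variable {α A : ℝ} {h : ℂ → ℂ} {C d : ℂ}

theorem add_mem_borelHalfPlane (hC : C ∈ borelHalfPlane α A) {v : ℂ}
    (hv : (exp (I * α) * v).re ≤ 0) : C + v ∈ borelHalfPlane α A := by
  change (_ : ℂ).re < A at hC ⊢
  rw [mul_add, Complex.add_re]; linarith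

theorem IsBorelDir.re_mul_ofReal_nonpos (hd : IsBorelDir α d) {r : ℝ} (hr : 0 ≤ r) :
    (exp (I * α) * (d * r)).re ≤ 0 := by
  rw [← mul_assoc, Complex.re_mul_ofReal]
  exact mul_nonpos_of_nonpos_of_nonneg hd.2 hr

theorem IsBorelDir.add_mem (hd : IsBorelDir α d) (hC : C ∈ borelHalfPlane α A) {r : ℝ}
    (hr : 0 ≤ r) : C + d * r ∈ borelHalfPlane α A :=
  add_mem_borelHalfPlane hC (hd.re_mul_ofReal_nonpos hr)

/-- Of the decay rate `m` of the kernel, one half pays for the growth of `h` and the other half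
survives. The point `τ` is not tied to a ray, so the bound also serves on segments joining two rays.
-/
theorem norm_mul_exp_le {K m R : ℝ} (hm : 0 ≤ m) {ξ τ : ℂ}
    (hK : ‖h τ‖ ≤ K * Real.exp (m / 2 * ‖τ‖)) (hR : ‖τ - C‖ ≤ R)
    (hξ : m * R ≤ (ξ * (τ - C)).re) :
    ‖h τ * exp (-(ξ * τ))‖ ≤
      Real.exp (-(ξ * C).re) * (K * Real.exp (m / 2 * ‖C‖)) * Real.exp (-(m / 2) * R) := by
  have hK0 : 0 ≤ K := by
    by_contra hK0
    have := mul_neg_of_neg_of_pos (not_le.1 hK0) (Real.exp_pos (m / 2 * ‖τ‖))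
    linarith [norm_nonneg (h τ)]
  rw [norm_mul, Complex.norm_exp]
  have h1 : ‖τ‖ ≤ ‖C‖ + R := by
    calc ‖τ‖ = ‖C + (τ - C)‖ := by congr 1; ring
      _ ≤ _ := (norm_add_le _ _).trans (by linarith)
  have h2 : (-(ξ * τ)).re ≤ -(ξ * C).re - m * R := by
    have : -(ξ * τ) = -(ξ * C) - ξ * (τ - C) := by ring
    rw [this, Complex.sub_re, Complex.neg_re]; linarith
  calc ‖h τ‖ * Real.exp (-(ξ * τ)).re
      ≤ (K * Real.exp (m / 2 * (‖C‖ + R))) * Real.exp (-(ξ * C).re - m * R) := by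
        refine mul_le_mul (hK.trans ?_) (Real.exp_le_exp.2 h2) (Real.exp_pos _).le (by positivity)
        gcongr
    _ = _ := by
        rw [show Real.exp (-(ξ * C).re) * (K * Real.exp (m / 2 * ‖C‖)) * Real.exp (-(m / 2) * R)
          = K * (Real.exp (-(ξ * C).re) * Real.exp (m / 2 * ‖C‖) * Real.exp (-(m / 2) * R)) by ring,
          mul_assoc, ← Real.exp_add, ← Real.exp_add, ← Real.exp_add]
        congr 2; ring

theorem norm_rayLaplace_integrand_le (hC : C ∈ borelHalfPlane α A) (hd : IsBorelDir α d)
    {K m : ℝ} (hm : 0 ≤ m)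
    (hK : ∀ τ ∈ borelHalfPlane α A, ‖h τ‖ ≤ K * Real.exp (m / 2 * ‖τ‖)) {ξ : ℂ}
    (hξ : m ≤ (d * ξ).re) {r : ℝ} (hr : 0 ≤ r) :
    ‖h (C + d * r) * exp (-(ξ * (C + d * r))) * d‖ ≤
      Real.exp (-(ξ * C).re) * (K * Real.exp (m / 2 * ‖C‖)) * Real.exp (-(m / 2) * r) := by
  rw [norm_mul, hd.1, mul_one]
  refine norm_mul_exp_le hm (hK _ (hd.add_mem hC hr)) ?_ ?_
  · simp [hd.1, abs_of_nonneg hr]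
  · rw [show ξ * (C + d * r - C) = d * ξ * r by ring, Complex.re_mul_ofReal]
    exact mul_le_mul_of_nonneg_right hξ hr

theorem continuousOn_rayLaplace_integrand (hh : ContinuousOn h (borelHalfPlane α A))
    (hC : C ∈ borelHalfPlane α A) (hd : IsBorelDir α d) (ξ : ℂ) :
    ContinuousOn (fun r : ℝ => h (C + d * r) * exp (-(ξ * (C + d * r))) * d) (Ici 0) := by
  have : ContinuousOn (fun r : ℝ => h (C + d * r)) (Ici 0) :=
    hh.comp (by fun_prop) fun r hr => hd.add_mem hC hr
  exact (this.mul (by fun_prop)).mul continuousOn_const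

theorem aestronglyMeasurable_rayLaplace_integrand (hh : ContinuousOn h (borelHalfPlane α A))
    (hC : C ∈ borelHalfPlane α A) (hd : IsBorelDir α d) (ξ : ℂ) :
    AEStronglyMeasurable (fun r : ℝ => h (C + d * r) * exp (-(ξ * (C + d * r))) * d)
      (volume.restrict (Ioi 0)) :=
  ((continuousOn_rayLaplace_integrand hh hC hd ξ).mono Ioi_subset_Ici_self).aestronglyMeasurable
    measurableSet_Ioi

theorem integrableOn_exp_neg_half {m : ℝ} (hm : 0 < m) (c : ℝ) :
    IntegrableOn (fun r : ℝ => c * Real.exp (-(m / 2) * r)) (Ioi 0) :=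
  (exp_neg_integrableOn_Ioi 0 (half_pos hm)).const_mul c

theorem integrableOn_rayLaplace_of_bound (hh : ContinuousOn h (borelHalfPlane α A))
    (hC : C ∈ borelHalfPlane α A) (hd : IsBorelDir α d) {K m : ℝ} (hm : 0 < m)
    (hK : ∀ τ ∈ borelHalfPlane α A, ‖h τ‖ ≤ K * Real.exp (m / 2 * ‖τ‖)) {ξ : ℂ}
    (hξ : m ≤ (d * ξ).re) :
    IntegrableOn (fun r : ℝ => h (C + d * r) * exp (-(ξ * (C + d * r))) * d) (Ioi 0) := by
  refine Integrable.mono' (integrableOn_exp_neg_half hm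
    (Real.exp (-(ξ * C).re) * (K * Real.exp (m / 2 * ‖C‖))))
    (aestronglyMeasurable_rayLaplace_integrand hh hC hd ξ) ?_
  filter_upwards [ae_restrict_mem measurableSet_Ioi] with r hr
  exact norm_rayLaplace_integrand_le hC hd hm.le hK hξ (mem_Ioi.1 hr).le

theorem integrableOn_rayLaplace (hh : ContinuousOn h (borelHalfPlane α A))
    (hs : IsSubexpOn (borelHalfPlane α A) h)
    (hC : C ∈ borelHalfPlane α A) (hd : IsBorelDir α d) {ξ : ℂ} (hξ : 0 < (d * ξ).re) :
    IntegrableOn (fun r : ℝ => h (C + d * r) * exp (-(ξ * (C + d * r))) * d) (Ioi 0) := by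
  obtain ⟨K, hK⟩ := hs _ (half_pos hξ)
  exact integrableOn_rayLaplace_of_bound hh hC hd hξ hK le_rfl

theorem norm_rayLaplace_le (hC : C ∈ borelHalfPlane α A) (hd : IsBorelDir α d) {K m : ℝ}
    (hm : 0 < m) (hK : ∀ τ ∈ borelHalfPlane α A, ‖h τ‖ ≤ K * Real.exp (m / 2 * ‖τ‖)) {ξ : ℂ}
    (hξ : m ≤ (d * ξ).re) :
    ‖rayLaplace h C d ξ‖ ≤
      Real.exp (-(ξ * C).re) * (K * Real.exp (m / 2 * ‖C‖)) * (2 / m) := by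
  have h1 : ∫ r in Ioi (0 : ℝ), Real.exp (-(ξ * C).re) * (K * Real.exp (m / 2 * ‖C‖)) *
      Real.exp (-(m / 2) * r) =
      Real.exp (-(ξ * C).re) * (K * Real.exp (m / 2 * ‖C‖)) * (2 / m) := by
    rw [integral_const_mul, integral_exp_mul_Ioi (by linarith)]
    simp
  rw [← h1]
  refine norm_integral_le_of_norm_le (integrableOn_exp_neg_half hm _) ?_
  filter_upwards [ae_restrict_mem measurableSet_Ioi] with r hr
  exact norm_rayLaplace_integrand_le hC hd hm.le hK hξ (mem_Ioi.1 hr).le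

/-- The Laplace integral does not depend on the direction of the ray. -/
theorem rayLaplace_eq_rayLaplace (hh : DifferentiableOn ℂ h (borelHalfPlane α A))
    (hs : IsSubexpOn (borelHalfPlane α A) h) (hC : C ∈ borelHalfPlane α A) {d₁ d₂ ξ : ℂ}
    (hd₁ : IsBorelDir α d₁) (hd₂ : IsBorelDir α d₂) (hξ₁ : 0 < (d₁ * ξ).re)
    (hξ₂ : 0 < (d₂ * ξ).re) : rayLaplace h C d₁ ξ = rayLaplace h C d₂ ξ := by
  set P := borelHalfPlane α A with hP
  obtain ⟨G, hG⟩ := (convex_borelHalfPlane α A).exists_forall_hasDerivWithinAt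
    (f := fun τ => h τ * exp (-(ξ * τ))) (hh.mul (by fun_prop))
  have hG' : ∀ τ ∈ P, HasDerivAt G (h τ * exp (-(ξ * τ))) τ := fun τ hτ =>
    (hG τ hτ).hasDerivAt ((isOpen_borelHalfPlane α A).mem_nhds hτ)
  have hlim : ∀ d, IsBorelDir α d → 0 < (d * ξ).re →
      Tendsto (fun R : ℝ => G (C + d * R) - G C) atTop (𝓝 (rayLaplace h C d ξ)) := by
    intro d hd hξ
    refine (intervalIntegral_tendsto_integral_Ioi 0
      (integrableOn_rayLaplace hh.continuousOn hs hC hd hξ) tendsto_id).congr' ?_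
    filter_upwards [eventually_ge_atTop 0] with R hR
    have hcont := continuousOn_rayLaplace_integrand hh.continuousOn hC hd ξ
    have h1 : ∀ r ∈ uIcc 0 R, HasDerivAt (fun r : ℝ => G (C + d * r))
        (h (C + d * r) * exp (-(ξ * (C + d * r))) * d) r := by
      intro r hr
      rw [uIcc_of_le hR] at hr
      have h2 : HasDerivAt (fun r : ℝ => C + d * (r : ℂ)) d r := by
        simpa using ((Complex.ofRealCLM.hasDerivAt (x := r)).const_mul d).const_add C
      exact (hG' _ (hd.add_mem hC hr.1)).comp r h2
    have h3 := intervalIntegral.integral_eq_sub_of_hasDerivAt h1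
      ((hcont.mono (by rw [uIcc_of_le hR]; exact Icc_subset_Ici_self)).intervalIntegrable)
    simpa using h3
  set m := min (d₁ * ξ).re (d₂ * ξ).re with hm
  have hm0 : 0 < m := lt_min hξ₁ hξ₂
  obtain ⟨K, hK⟩ := hs (m / 2) (half_pos hm0)
  -- The two truncated integrals differ by the increment of the primitive `G` between the far
  -- endpoints of the rays. These are at distance at most `2R`, while the integrand between them is
  -- `O(e^{-mR/2})`.
  have hdiff : Tendsto (fun R : ℝ => (G (C + d₁ * R) - G C) - (G (C + d₂ * R) - G C)) atTop
      (𝓝 0) := by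
    have hz : Tendsto (fun R : ℝ => Real.exp (-(ξ * C).re) * (K * Real.exp (m / 2 * ‖C‖)) * 2 *
        (R * Real.exp (-(m / 2) * R))) atTop (𝓝 0) := by
      have h1 := (Real.tendsto_pow_mul_exp_neg_atTop_nhds_zero 1).comp
        (tendsto_id.const_mul_atTop (half_pos hm0))
      have h2 := h1.const_mul (Real.exp (-(ξ * C).re) * (K * Real.exp (m / 2 * ‖C‖)) * 2 *
        (2 / m))
      rw [mul_zero] at h2
      refine h2.congr fun R => ?_
      simp only [Function.comp_apply, id_eq, pow_one, neg_mul]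
      field_simp
    refine squeeze_zero_norm' ?_ hz
    filter_upwards [eventually_ge_atTop 0] with R hR
    -- A convex set containing both endpoints, cut out by exactly the conditions that keep it in the
    -- half-plane and make `norm_mul_exp_le` applicable; the mean value inequality then applies on
    -- it.
    let S : Set ℂ := {τ | ‖τ - C‖ ≤ R ∧ m * R ≤ (ξ * (τ - C)).re ∧ (exp (I * α) * (τ - C)).re ≤ 0}
    have hS : Convex ℝ S := by
      rintro x ⟨hx1, hx2, hx3⟩ y ⟨hy1, hy2, hy3⟩ a b ha hb hab
      have hsub : a • x + b • y - C = a • (x - C) + b • (y - C) := by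
        rw [smul_sub, smul_sub, ← add_sub_add_comm, ← add_smul, hab, one_smul]
      refine ⟨?_, ?_, ?_⟩
      · rw [hsub]
        calc _ ≤ a * ‖x - C‖ + b * ‖y - C‖ := by
              refine (norm_add_le _ _).trans ?_
              rw [norm_smul, norm_smul, Real.norm_of_nonneg ha, Real.norm_of_nonneg hb]
          _ ≤ a * R + b * R := by gcongr
          _ = R := by rw [← add_mul, hab, one_mul]
      · rw [hsub, re_mul_combo]
        calc m * R = a * (m * R) + b * (m * R) := by rw [← add_mul, hab, one_mul]
          _ ≤ _ := by gcongr
      · rw [hsub, re_mul_combo]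
        nlinarith
    have hSP : S ⊆ P := fun τ hτ => by
      have := add_mem_borelHalfPlane hC hτ.2.2
      simpa using this
    have hmem : ∀ d, IsBorelDir α d → m ≤ (d * ξ).re → C + d * R ∈ S := by
      intro d hd hdm
      refine ⟨by simp [hd.1, abs_of_nonneg hR], ?_, ?_⟩
      · rw [show ξ * (C + d * R - C) = d * ξ * R by ring, Complex.re_mul_ofReal]
        exact mul_le_mul_of_nonneg_right hdm hR
      · simpa using hd.re_mul_ofReal_nonpos hR
    have hle := hS.norm_image_sub_le_of_norm_hasDerivWithin_le (f := G)
      (fun τ hτ => (hG' τ (hSP hτ)).hasDerivWithinAt)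
      (fun τ hτ => norm_mul_exp_le hm0.le (hK τ (hSP hτ)) hτ.1 hτ.2.1)
      (hmem d₂ hd₂ (min_le_right _ _)) (hmem d₁ hd₁ (min_le_left _ _))
    rw [sub_sub_sub_cancel_right]
    refine hle.trans ?_
    have h5 : ‖C + d₁ * R - (C + d₂ * R)‖ ≤ 2 * R := by
      rw [show C + d₁ * R - (C + d₂ * R) = (d₁ - d₂) * R by ring, norm_mul, Complex.norm_real,
        Real.norm_of_nonneg hR]
      gcongr
      calc _ ≤ ‖d₁‖ + ‖d₂‖ := norm_sub_le _ _
        _ = 2 := by rw [hd₁.1, hd₂.1]; norm_num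
    calc _ ≤ Real.exp (-(ξ * C).re) * (K * Real.exp (m / 2 * ‖C‖)) * Real.exp (-(m / 2) * R) *
          (2 * R) := by
          refine mul_le_mul_of_nonneg_left h5 ((norm_nonneg _).trans
            (norm_mul_exp_le hm0.le (hK _ (hSP (hmem d₂ hd₂ (min_le_right _ _))))
              (hmem d₂ hd₂ (min_le_right _ _)).1 (hmem d₂ hd₂ (min_le_right _ _)).2.1))
      _ = _ := by ring
  have := tendsto_nhds_unique hdiff ((hlim d₁ hd₁ hξ₁).sub (hlim d₂ hd₂ hξ₂))
  exact (sub_eq_zero.1 this.symm)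

theorem IsSubexpOn.id_mul {P : Set ℂ} (hs : IsSubexpOn P h) : IsSubexpOn P fun τ => τ * h τ := by
  intro ε hε
  obtain ⟨K, hK⟩ := hs (ε / 2) (half_pos hε)
  refine ⟨2 / ε * K, fun τ hτ => ?_⟩
  have h1 : ‖τ‖ ≤ 2 / ε * Real.exp (ε / 2 * ‖τ‖) := by
    have := Real.add_one_le_exp (ε / 2 * ‖τ‖)
    rw [div_mul_eq_mul_div, le_div_iff₀ hε]
    linarith
  calc ‖τ * h τ‖ = ‖τ‖ * ‖h τ‖ := norm_mul _ _
    _ ≤ (2 / ε * Real.exp (ε / 2 * ‖τ‖)) * (K * Real.exp (ε / 2 * ‖τ‖)) :=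
      mul_le_mul h1 (hK τ hτ) (norm_nonneg _) (by positivity)
    _ = 2 / ε * K * (Real.exp (ε / 2 * ‖τ‖) * Real.exp (ε / 2 * ‖τ‖)) := by ring
    _ = _ := by rw [← Real.exp_add]; congr 2; ring

theorem IsSubexpOn.add {P : Set ℂ} {h₁ h₂ : ℂ → ℂ} (hs₁ : IsSubexpOn P h₁)
    (hs₂ : IsSubexpOn P h₂) : IsSubexpOn P fun τ => h₁ τ + h₂ τ := by
  intro ε hε
  obtain ⟨K₁, hK₁⟩ := hs₁ ε hε
  obtain ⟨K₂, hK₂⟩ := hs₂ ε hε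
  refine ⟨K₁ + K₂, fun τ hτ => ?_⟩
  rw [add_mul]
  exact (norm_add_le _ _).trans (add_le_add (hK₁ τ hτ) (hK₂ τ hτ))

theorem IsSubexpOn.const_mul {P : Set ℂ} (hs : IsSubexpOn P h) (c : ℂ) :
    IsSubexpOn P fun τ => c * h τ := by
  intro ε hε
  obtain ⟨K, hK⟩ := hs ε hε
  refine ⟨‖c‖ * K, fun τ hτ => ?_⟩
  rw [norm_mul, mul_assoc]
  exact mul_le_mul_of_nonneg_left (hK τ hτ) (norm_nonneg _)

theorem isSubexpOn_const (P : Set ℂ) (c : ℂ) : IsSubexpOn P fun _ => c := by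
  intro ε hε
  refine ⟨‖c‖, fun τ _ => le_mul_of_one_le_right (norm_nonneg _) ?_⟩
  exact Real.one_le_exp (by positivity)

/-- Differentiation under the integral: on a ball of radius half of `Re (d ξ₀)`, half of the decay
remains uniformly, and the extra factor `τ` costs nothing since it preserves subexponential growth.
-/
theorem hasDerivAt_rayLaplace (hh : ContinuousOn h (borelHalfPlane α A))
    (hs : IsSubexpOn (borelHalfPlane α A) h) (hC : C ∈ borelHalfPlane α A)
    (hd : IsBorelDir α d) {ξ₀ : ℂ} (hξ₀ : 0 < (d * ξ₀).re) :
    HasDerivAt (rayLaplace h C d) (-rayLaplace (fun τ => τ * h τ) C d ξ₀) ξ₀ := by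
  set m := (d * ξ₀).re / 2 with hm
  have hm0 : 0 < m := half_pos hξ₀
  obtain ⟨K, hK⟩ := hs.id_mul (m / 2) (half_pos hm0)
  have hball : ∀ ξ ∈ Metric.ball ξ₀ m, m ≤ (d * ξ).re := by
    intro ξ hξ
    rw [Metric.mem_ball, dist_eq_norm] at hξ
    have h1 := (Complex.abs_re_le_norm (d * (ξ - ξ₀)))
    rw [norm_mul, hd.1, one_mul, mul_sub, Complex.sub_re] at h1
    linarith [(abs_le.1 h1).1]
  have hK0 : 0 ≤ K := by
    have h0 := (norm_nonneg _).trans (hK C hC)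
    by_contra hneg
    linarith [mul_neg_of_neg_of_pos (not_le.1 hneg) (Real.exp_pos (m / 2 * ‖C‖))]
  have key := hasDerivAt_integral_of_dominated_loc_of_deriv_le (μ := volume.restrict (Ioi (0 : ℝ)))
    (F := fun ξ r => h (C + d * r) * exp (-(ξ * (C + d * r))) * d) (x₀ := ξ₀)
    (F' := fun ξ r => -(((C + d * r) * h (C + d * r)) * exp (-(ξ * (C + d * r))) * d))
    (bound := fun r => Real.exp ((‖ξ₀‖ + m) * ‖C‖) * (K * Real.exp (m / 2 * ‖C‖)) *
      Real.exp (-(m / 2) * r)) (Metric.ball_mem_nhds ξ₀ hm0)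
    (Eventually.of_forall fun ξ => aestronglyMeasurable_rayLaplace_integrand hh hC hd ξ)
    (integrableOn_rayLaplace hh hs hC hd hξ₀)
    (aestronglyMeasurable_rayLaplace_integrand (h := fun τ => τ * h τ)
      (continuousOn_id.mul hh) hC hd ξ₀).neg ?_ (integrableOn_exp_neg_half hm0 _) ?_
  · have := key.2
    rw [integral_neg] at this
    exact this
  · filter_upwards [ae_restrict_mem measurableSet_Ioi] with r hr ξ hξ
    rw [norm_neg]
    refine (norm_rayLaplace_integrand_le hC hd hm0.le hK (hball ξ hξ) (mem_Ioi.1 hr).le).trans ?_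
    gcongr
    rw [Metric.mem_ball, dist_eq_norm] at hξ
    have h1 : ‖ξ‖ ≤ ‖ξ₀‖ + m := by
      calc ‖ξ‖ = ‖ξ₀ + (ξ - ξ₀)‖ := by congr 1; ring
        _ ≤ _ := (norm_add_le _ _).trans (by linarith)
    have h2 := (abs_le.1 (Complex.abs_re_le_norm (ξ * C))).1
    rw [norm_mul] at h2
    nlinarith [norm_nonneg C]
  · refine Eventually.of_forall fun r ξ _ => ?_
    have h1 : HasDerivAt (fun ξ : ℂ => -(ξ * (C + d * r))) (-(1 * (C + d * r))) ξ :=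
      ((hasDerivAt_id ξ).mul_const _).neg
    have h2 := (h1.cexp.const_mul (h (C + d * r))).mul_const d
    refine h2.congr_deriv ?_
    ring

end

/-! ### The major Borel transform off the ray. -/

/-- The major Borel transform of `h` in the direction `α`, off the ray `e^{iα} ℝ≥0`. -/
noncomputable def majorBorel (α : ℝ) (C : ℂ) (h : ℂ → ℂ) (ξ : ℂ) : ℂ :=
  open Classical in
  1 / (2 * Real.pi * I) *
    if H : ∃ d, IsBorelDir α d ∧ 0 < (d * ξ).re then rayLaplace h C H.choose ξ else 0

/-- The plane slit along the ray `e^{iα} ℝ≥0`. -/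
def raySlitPlane (α : ℝ) : Set ℂ := {ξ | -(exp (-(I * α)) * ξ) ∈ slitPlane}

theorem isOpen_raySlitPlane (α : ℝ) : IsOpen (raySlitPlane α) :=
  isOpen_slitPlane.preimage (by fun_prop)

theorem exp_neg_I_mul_cancel_left (α : ℝ) (z : ℂ) : exp (-(I * α)) * (exp (I * α) * z) = z := by
  rw [← mul_assoc, mul_comm (exp _) (exp _), exp_I_mul_exp_neg, one_mul]

theorem exp_I_mul_cancel_left (α : ℝ) (z : ℂ) : exp (I * α) * (exp (-(I * α)) * z) = z := by
  rw [← mul_assoc, exp_I_mul_exp_neg, one_mul]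

theorem isBorelDir_exp_neg_mul {α : ℝ} {v : ℂ} (hv : ‖v‖ = 1) (hre : v.re ≤ 0) :
    IsBorelDir α (exp (-(I * α)) * v) :=
  ⟨by rw [norm_mul, norm_exp_neg_I_mul, hv, one_mul], by rwa [exp_I_mul_cancel_left]⟩

theorem mem_raySlitPlane_iff {α : ℝ} {z : ℂ} :
    exp (I * α) * z ∈ raySlitPlane α ↔ z.re < 0 ∨ z.im ≠ 0 := by
  rw [raySlitPlane, Set.mem_ofPred_eq, exp_neg_I_mul_cancel_left, mem_slitPlane_iff]
  simp

/-- In the coordinate `z = e^{-iα} ξ`, the three directions `-1`, `i`, `-i`, turned by `e^{-iα}`,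
serve the half-planes `Re z < 0`, `Im z < 0`, `Im z > 0`, which cover the slit plane. The last two
are parallel to the boundary of the half-plane, which is why `IsBorelDir` is a closed condition. -/
theorem exists_isBorelDir {α : ℝ} {ξ : ℂ} (hξ : ξ ∈ raySlitPlane α) :
    ∃ d, IsBorelDir α d ∧ 0 < (d * ξ).re := by
  obtain ⟨z, rfl⟩ : ∃ z, exp (I * α) * z = ξ := ⟨_, exp_I_mul_cancel_left α ξ⟩
  have key : ∀ v : ℂ, exp (-(I * α)) * v * (exp (I * α) * z) = v * z := fun v => by
    rw [mul_comm _ v, mul_assoc, exp_neg_I_mul_cancel_left]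
  rcases mem_raySlitPlane_iff.1 hξ with h | h
  · exact ⟨_, isBorelDir_exp_neg_mul (v := -1) (by simp) (by simp), by rw [key]; simpa using h⟩
  · rcases lt_or_gt_of_ne h with h | h
    · exact ⟨_, isBorelDir_exp_neg_mul (v := I) (by simp) (by simp), by rw [key]; simpa using h⟩
    · exact ⟨_, isBorelDir_exp_neg_mul (v := -I) (by simp) (by simp), by rw [key]; simpa using h⟩

section

variable {α A : ℝ} {h : ℂ → ℂ} {C d : ℂ}

/-- The direction chosen in the definition is immaterial, by independence of the ray; everywhere
below a convenient direction may be used. -/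
theorem majorBorel_eq (hh : DifferentiableOn ℂ h (borelHalfPlane α A))
    (hs : IsSubexpOn (borelHalfPlane α A) h) (hC : C ∈ borelHalfPlane α A) {ξ : ℂ}
    (hd : IsBorelDir α d) (hξ : 0 < (d * ξ).re) :
    majorBorel α C h ξ = 1 / (2 * Real.pi * I) * rayLaplace h C d ξ := by
  have H : ∃ d, IsBorelDir α d ∧ 0 < (d * ξ).re := ⟨d, hd, hξ⟩
  rw [majorBorel, dif_pos H, rayLaplace_eq_rayLaplace hh hs hC H.choose_spec.1 hd H.choose_spec.2 hξ]

/-- A direction admissible at `ξ` is admissible nearby, so locally the transform is a single Laplace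
integral. That multiplication by `τ` becomes `-d/dξ` is what makes the inversion formula work. -/
theorem hasDerivAt_majorBorel (hh : DifferentiableOn ℂ h (borelHalfPlane α A))
    (hs : IsSubexpOn (borelHalfPlane α A) h) (hC : C ∈ borelHalfPlane α A) {ξ : ℂ}
    (hξ : ξ ∈ raySlitPlane α) :
    HasDerivAt (majorBorel α C h) (-majorBorel α C (fun τ => τ * h τ) ξ) ξ := by
  obtain ⟨d, hd, hdξ⟩ := exists_isBorelDir hξ
  rw [majorBorel_eq (h := fun τ => τ * h τ) (differentiableOn_id.mul hh) hs.id_mul hC hd hdξ, ← mul_neg]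
  refine ((hasDerivAt_rayLaplace hh.continuousOn hs hC hd hdξ).const_mul
    (1 / (2 * Real.pi * I))).congr_of_eventuallyEq ?_
  have : ∀ᶠ w in 𝓝 ξ, 0 < (d * w).re :=
    (isOpen_lt continuous_const (by fun_prop)).mem_nhds hdξ
  filter_upwards [this] with w hw
  exact majorBorel_eq hh hs hC hd hw

theorem norm_majorBorel_le (hh : DifferentiableOn ℂ h (borelHalfPlane α A))
    (hs : IsSubexpOn (borelHalfPlane α A) h) (hC : C ∈ borelHalfPlane α A)
    (hd : IsBorelDir α d) {K m : ℝ} (hm : 0 < m)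
    (hK : ∀ τ ∈ borelHalfPlane α A, ‖h τ‖ ≤ K * Real.exp (m / 2 * ‖τ‖)) {ξ : ℂ}
    (hξ : m ≤ (d * ξ).re) :
    ‖majorBorel α C h ξ‖ ≤
      Real.exp (-(ξ * C).re) * (K * Real.exp (m / 2 * ‖C‖)) * (2 / m) := by
  rw [majorBorel_eq hh hs hC hd (hm.trans_le hξ), norm_mul]
  have h1 : ‖(1 / (2 * Real.pi * I) : ℂ)‖ ≤ 1 := by
    simp only [norm_div, norm_one, norm_mul, Complex.norm_ofNat, Complex.norm_real, Complex.norm_I,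
      mul_one, Real.norm_of_nonneg Real.pi_pos.le]
    rw [div_le_one (by positivity)]
    linarith [Real.pi_gt_three]
  exact (mul_le_of_le_one_left (norm_nonneg _) h1).trans (norm_rayLaplace_le hC hd hm hK hξ)

theorem isMajorBorel_majorBorel (hh : DifferentiableOn ℂ h (borelHalfPlane α A))
    (hs : IsSubexpOn (borelHalfPlane α A) h) (hC : C ∈ borelHalfPlane α A) :
    IsMajorBorel α C h (majorBorel α C h) := by
  intro β hβ ξ hξ
  have hd : IsBorelDir α (exp (-(I * β))) := by
    refine ⟨norm_exp_neg_I_mul β, ?_⟩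
    have h1 : exp (I * α) * exp (-(I * β)) = exp (((α - β : ℝ) : ℂ) * I) := by
      rw [← Complex.exp_add]; congr 1; push_cast; ring
    rw [h1, Complex.exp_ofReal_mul_I_re, ← Real.cos_neg, neg_sub]
    exact Real.cos_nonpos_of_pi_div_two_le_of_le (by linarith [hβ.1]) (by linarith [hβ.2])
  exact ⟨integrableOn_rayLaplace hh.continuousOn hs hC hd hξ, majorBorel_eq hh hs hC hd hξ⟩

theorem rayLaplace_add {h₁ h₂ : ℂ → ℂ} {ξ : ℂ}
    (hi₁ : IntegrableOn (fun r : ℝ => h₁ (C + d * r) * exp (-(ξ * (C + d * r))) * d) (Ioi 0))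
    (hi₂ : IntegrableOn (fun r : ℝ => h₂ (C + d * r) * exp (-(ξ * (C + d * r))) * d) (Ioi 0)) :
    rayLaplace (fun τ => h₁ τ + h₂ τ) C d ξ = rayLaplace h₁ C d ξ + rayLaplace h₂ C d ξ := by
  simp only [rayLaplace]
  rw [← integral_add hi₁ hi₂]
  congr 1; ext r; ring

theorem majorBorel_add {h₁ h₂ : ℂ → ℂ} (hh₁ : DifferentiableOn ℂ h₁ (borelHalfPlane α A))
    (hh₂ : DifferentiableOn ℂ h₂ (borelHalfPlane α A))
    (hs₁ : IsSubexpOn (borelHalfPlane α A) h₁) (hs₂ : IsSubexpOn (borelHalfPlane α A) h₂)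
    (hC : C ∈ borelHalfPlane α A) {ξ : ℂ} (hξ : ξ ∈ raySlitPlane α) :
    majorBorel α C (fun τ => h₁ τ + h₂ τ) ξ = majorBorel α C h₁ ξ + majorBorel α C h₂ ξ := by
  obtain ⟨d, hd, hdξ⟩ := exists_isBorelDir hξ
  rw [majorBorel_eq hh₁ hs₁ hC hd hdξ, majorBorel_eq hh₂ hs₂ hC hd hdξ,
    majorBorel_eq (h := fun τ => h₁ τ + h₂ τ) (hh₁.add hh₂) (hs₁.add hs₂) hC hd hdξ, rayLaplace_add
      (integrableOn_rayLaplace hh₁.continuousOn hs₁ hC hd hdξ)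
      (integrableOn_rayLaplace hh₂.continuousOn hs₂ hC hd hdξ), mul_add]

theorem majorBorel_const_mul (h : ℂ → ℂ) (c ξ : ℂ) :
    majorBorel α C (fun τ => c * h τ) ξ = c * majorBorel α C h ξ := by
  have : ∀ d, rayLaplace (fun τ => c * h τ) C d ξ = c * rayLaplace h C d ξ := by
    intro d
    simp only [rayLaplace]
    rw [← integral_const_mul]
    congr 1; ext r; ring
  unfold majorBorel
  split_ifs
  · rw [this]; ring
  · simp

/-- The major Borel transform of the constant `1` is `e^{-ξ C} / (2πi ξ)`. -/
theorem majorBorel_one (hC : C ∈ borelHalfPlane α A) {ξ : ℂ} (hξ : ξ ∈ raySlitPlane α) :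
    majorBorel α C (fun _ => 1) ξ = 1 / (2 * Real.pi * I) * (exp (-(ξ * C)) / ξ) := by
  obtain ⟨d, hd, hdξ⟩ := exists_isBorelDir hξ
  rw [majorBorel_eq (A := A) (differentiableOn_const 1) (isSubexpOn_const _ 1) hC hd hdξ]
  congr 1
  have hd0 : d ≠ 0 := by rintro rfl; simp at hdξ
  have hξ0 : ξ ≠ 0 := by rintro rfl; simp at hdξ
  have h1 : ∀ r : ℝ, 1 * exp (-(ξ * (C + d * r))) * d =
      exp (-(ξ * C)) * d * exp (-(d * ξ) * r) := by
    intro r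
    rw [one_mul, show -(ξ * (C + d * r)) = -(ξ * C) + -(d * ξ) * r by ring, Complex.exp_add]
    ring
  simp only [rayLaplace, h1]
  rw [integral_const_mul, integral_exp_mul_complex_Ioi (by simpa using hdξ)]
  field_simp
  simp

end

/-! ### Hankel contours in a slit half-strip. -/

/-- The half-strip of half-width `η` around `e^{iα} ℝ≥0`, slit along this ray. -/
def slitStrip (α η : ℝ) : Set ℂ :=
  {ξ | -η < (exp (-(I * α)) * ξ).re ∧ |(exp (-(I * α)) * ξ).im| < η} ∩ raySlitPlane α

theorem exp_mul_mem_slitStrip_iff {α η : ℝ} {z : ℂ} :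
    exp (I * α) * z ∈ slitStrip α η ↔ (-η < z.re ∧ |z.im| < η) ∧ (z.re < 0 ∨ z.im ≠ 0) := by
  rw [slitStrip, mem_inter_iff, mem_raySlitPlane_iff, Set.mem_ofPred_eq, exp_neg_I_mul_cancel_left]

theorem isOpen_slitStrip (α η : ℝ) : IsOpen (slitStrip α η) :=
  ((isOpen_lt continuous_const
      (show Continuous fun ξ : ℂ => (exp (-(I * α)) * ξ).re by fun_prop)).inter
    (isOpen_lt (show Continuous fun ξ : ℂ => |(exp (-(I * α)) * ξ).im| by fun_prop)
      continuous_const)).inter (isOpen_raySlitPlane α)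

section contour

variable {α η δ ε : ℝ}

theorem upper_mem_slitStrip (hδ : δ ∈ Ioo 0 η) (hε : ε ∈ Ioo 0 η) {x : ℝ} (hx : -δ ≤ x) :
    exp (I * α) * (x + I * ε) ∈ slitStrip α η := by
  rw [exp_mul_mem_slitStrip_iff]
  have h1 : |ε| < η := by rw [abs_of_pos hε.1]; exact hε.2
  refine ⟨⟨?_, by simpa using h1⟩, Or.inr (by simpa using hε.1.ne')⟩
  simp; linarith [hδ.2]

theorem lower_mem_slitStrip (hδ : δ ∈ Ioo 0 η) (hε : ε ∈ Ioo 0 η) {x : ℝ} (hx : -δ ≤ x) :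
    exp (I * α) * (x - I * ε) ∈ slitStrip α η := by
  rw [exp_mul_mem_slitStrip_iff]
  have h1 : |ε| < η := by rw [abs_of_pos hε.1]; exact hε.2
  refine ⟨⟨?_, by simpa using h1⟩, Or.inr (by simpa using hε.1.ne')⟩
  simp; linarith [hδ.2]

theorem left_mem_slitStrip (hδ : δ ∈ Ioo 0 η) (hε : ε ∈ Ioo 0 η) {y : ℝ}
    (hy : y ∈ Icc (-ε) ε) : exp (I * α) * (-δ + I * y) ∈ slitStrip α η := by
  rw [exp_mul_mem_slitStrip_iff]
  have h1 : |y| < η := (abs_le.2 hy).trans_lt hε.2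
  refine ⟨⟨?_, by simpa using h1⟩, Or.inl (by simpa using hδ.1)⟩
  simpa using hδ.2

theorem uIcc_neg_self (hε : 0 < ε) : uIcc ε (-ε) = Icc (-ε) ε :=
  uIcc_of_ge (by linarith)

theorem hankelIntegral_congr (hδ : δ ∈ Ioo 0 η) (hε : ε ∈ Ioo 0 η) {F G : ℂ → ℂ}
    (h : EqOn F G (slitStrip α η)) : hankelIntegral α δ ε F = hankelIntegral α δ ε G := by
  unfold hankelIntegral
  congr 1
  · congr 1
    · congr 1
      refine setIntegral_congr_fun measurableSet_Ioi fun x hx => ?_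
      simp only [h (upper_mem_slitStrip hδ hε (le_of_lt hx))]
    · refine intervalIntegral.integral_congr fun y hy => ?_
      rw [uIcc_neg_self hε.1] at hy
      simp only [h (left_mem_slitStrip hδ hε hy)]
  · refine setIntegral_congr_fun measurableSet_Ioi fun x hx => ?_
    simp only [h (lower_mem_slitStrip hδ hε (le_of_lt hx))]

theorem hankelIntegral_const_mul (c : ℂ) (F : ℂ → ℂ) :
    hankelIntegral α δ ε (fun ξ => c * F ξ) = c * hankelIntegral α δ ε F := by
  simp only [hankelIntegral, mul_assoc, integral_const_mul, intervalIntegral.integral_const_mul]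
  ring

theorem HankelIntegrable.add {F G : ℂ → ℂ} (hF : HankelIntegrable α δ ε F)
    (hG : HankelIntegrable α δ ε G) : HankelIntegrable α δ ε fun ξ => F ξ + G ξ :=
  ⟨Integrable.add hF.1 hG.1, IntervalIntegrable.add hF.2.1 hG.2.1, Integrable.add hF.2.2 hG.2.2⟩

theorem HankelIntegrable.const_mul {F : ℂ → ℂ} (hF : HankelIntegrable α δ ε F) (c : ℂ) :
    HankelIntegrable α δ ε fun ξ => c * F ξ :=
  ⟨Integrable.const_mul hF.1 c, IntervalIntegrable.const_mul hF.2.1 c,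
    Integrable.const_mul hF.2.2 c⟩

theorem hankelIntegral_add {F G : ℂ → ℂ} (hF : HankelIntegrable α δ ε F)
    (hG : HankelIntegrable α δ ε G) :
    hankelIntegral α δ ε (fun ξ => F ξ + G ξ) =
      hankelIntegral α δ ε F + hankelIntegral α δ ε G := by
  simp only [hankelIntegral, add_mul]
  rw [integral_add (Integrable.mul_const hF.1 _) (Integrable.mul_const hG.1 _),
    integral_add (Integrable.mul_const hF.2.2 _) (Integrable.mul_const hG.2.2 _),
    intervalIntegral.integral_add (hF.2.1.symm.mul_const _) (hG.2.1.symm.mul_const _)]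
  ring

/-- The integral of `‖F‖` over the Hankel contour. -/
noncomputable def hankelNorm (α δ ε : ℝ) (F : ℂ → ℂ) : ℝ :=
  (∫ x : ℝ in Ioi (-δ), ‖F (exp (I * α) * (x + I * ε))‖) +
  (∫ y : ℝ in (-ε)..ε, ‖F (exp (I * α) * (-δ + I * y))‖) +
  ∫ x : ℝ in Ioi (-δ), ‖F (exp (I * α) * (x - I * ε))‖

theorem norm_hankelIntegral_le (hδ : δ ∈ Ioo 0 η) (hε : ε ∈ Ioo 0 η) {F G : ℂ → ℂ}
    (hF : HankelIntegrable α δ ε F) {c : ℝ} (hc : ∀ ξ ∈ slitStrip α η, ‖G ξ‖ ≤ c * ‖F ξ‖) :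
    ‖hankelIntegral α δ ε G‖ ≤ c * hankelNorm α δ ε F := by
  have he := norm_exp_I_mul α
  unfold hankelIntegral hankelNorm
  rw [mul_add, mul_add, ← integral_const_mul, ← integral_const_mul,
    ← intervalIntegral.integral_const_mul]
  refine (norm_add_le _ _).trans (add_le_add ((norm_add_le _ _).trans (add_le_add ?_ ?_)) ?_)
  · rw [norm_neg]
    refine norm_integral_le_of_norm_le (Integrable.const_mul hF.1.norm c) ?_
    filter_upwards [ae_restrict_mem measurableSet_Ioi] with x hx
    rw [norm_mul, he, mul_one]
    exact hc _ (upper_mem_slitStrip hδ hε (le_of_lt hx))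
  · rw [intervalIntegral.integral_symm, norm_neg]
    refine intervalIntegral.norm_integral_le_of_norm_le (by linarith [hε.1]) ?_
      (hF.2.1.norm.const_mul c)
    refine Eventually.of_forall fun y hy => ?_
    rw [norm_mul, norm_mul, he, Complex.norm_I, mul_one, mul_one]
    exact hc _ (left_mem_slitStrip hδ hε (Ioc_subset_Icc_self hy))
  · refine norm_integral_le_of_norm_le (Integrable.const_mul hF.2.2.norm c) ?_
    filter_upwards [ae_restrict_mem measurableSet_Ioi] with x hx
    rw [norm_mul, he, mul_one]
    exact hc _ (lower_mem_slitStrip hδ hε (le_of_lt hx))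

theorem hasDerivAt_line {F G : ℂ → ℂ} {e c v : ℂ} {x : ℝ}
    (h : HasDerivAt G (F (e * (c + v * x))) (e * (c + v * x))) :
    HasDerivAt (fun x : ℝ => G (e * (c + v * x))) (F (e * (c + v * x)) * (e * v)) x := by
  have h1 : HasDerivAt (fun x : ℝ => e * (c + v * (x : ℂ))) (e * v) x := by
    simpa using (((Complex.ofRealCLM.hasDerivAt (x := x)).const_mul v).const_add c).const_mul e
  exact h.comp x h1

/-- Evaluation of a Hankel integral by a primitive. -/
theorem hankelIntegral_eq_of_hasDerivAt (hδ : δ ∈ Ioo 0 η) (hε : ε ∈ Ioo 0 η) {F G : ℂ → ℂ}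
    (hF : HankelIntegrable α δ ε F) (hG : ∀ ξ ∈ slitStrip α η, HasDerivAt G (F ξ) ξ) {a b : ℂ}
    (ha : Tendsto (fun x : ℝ => G (exp (I * α) * (x + I * ε))) atTop (𝓝 a))
    (hb : Tendsto (fun x : ℝ => G (exp (I * α) * (x - I * ε))) atTop (𝓝 b)) :
    hankelIntegral α δ ε F = b - a := by
  have h1 := integral_Ioi_of_hasDerivAt_of_tendsto' (a := -δ)
    (f := fun x : ℝ => G (exp (I * α) * (x + I * ε)))
    (f' := fun x : ℝ => F (exp (I * α) * (x + I * ε)) * exp (I * α)) (fun x hx => by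
      have := hG _ (upper_mem_slitStrip (α := α) hδ hε (mem_Ici.1 hx))
      rw [show (x : ℂ) + I * ε = I * ε + 1 * x by ring] at this
      simpa [add_comm] using hasDerivAt_line this) (Integrable.mul_const hF.1 _) ha
  have h2 := integral_Ioi_of_hasDerivAt_of_tendsto' (a := -δ)
    (f := fun x : ℝ => G (exp (I * α) * (x - I * ε)))
    (f' := fun x : ℝ => F (exp (I * α) * (x - I * ε)) * exp (I * α)) (fun x hx => by
      have := hG _ (lower_mem_slitStrip (α := α) hδ hε (mem_Ici.1 hx))
      rw [show (x : ℂ) - I * ε = -(I * ε) + 1 * x by ring] at this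
      simpa [sub_eq_neg_add] using hasDerivAt_line this) (Integrable.mul_const hF.2.2 _) hb
  have h3 := intervalIntegral.integral_eq_sub_of_hasDerivAt (a := ε) (b := -ε)
    (f := fun y : ℝ => G (exp (I * α) * (-δ + I * y)))
    (f' := fun y : ℝ => F (exp (I * α) * (-δ + I * y)) * (exp (I * α) * I)) (fun y hy => by
      rw [uIcc_neg_self hε.1] at hy
      exact hasDerivAt_line (hG _ (left_mem_slitStrip (α := α) hδ hε hy)))
      (hF.2.1.symm.mul_const _)
  rw [hankelIntegral, h1, h2, h3]
  push_cast
  simp only [mul_neg, sub_eq_add_neg]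
  ring

/-- `F` decays exponentially in the half-strip, uniformly at every distance from the ray. -/
def HasStripDecay (α η : ℝ) (F : ℂ → ℂ) : Prop :=
  ∀ m > 0, ∃ K κ : ℝ, 0 < κ ∧ ∀ z : ℂ, -η < z.re → |z.im| < η → m ≤ |z.im| →
    ‖F (exp (I * α) * z)‖ ≤ K * Real.exp (-κ * z.re)

theorem HasStripDecay.hankelIntegrable {F : ℂ → ℂ} (hd : HasStripDecay α η F)
    (hF : ContinuousOn F (slitStrip α η)) (hδ : δ ∈ Ioo 0 η) (hε : ε ∈ Ioo 0 η) :
    HankelIntegrable α δ ε F := by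
  obtain ⟨K, κ, hκ, hK⟩ := hd ε hε.1
  have hint : IntegrableOn (fun x : ℝ => K * Real.exp (-κ * x)) (Ioi (-δ)) :=
    (exp_neg_integrableOn_Ioi _ hκ).const_mul K
  have h1 : |ε| < η := by rw [abs_of_pos hε.1]; exact hε.2
  refine ⟨?_, ?_, ?_⟩
  · refine Integrable.mono' hint (ContinuousOn.aestronglyMeasurable (hF.comp (by fun_prop)
      fun x hx => upper_mem_slitStrip hδ hε (le_of_lt hx)) measurableSet_Ioi) ?_
    filter_upwards [ae_restrict_mem measurableSet_Ioi] with x hx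
    have := hK (x + I * ε) (by simp; linarith [mem_Ioi.1 hx, hδ.2]) (by simpa using h1)
      (by simpa using le_abs_self ε)
    simpa using this
  · refine ContinuousOn.intervalIntegrable ?_
    rw [uIcc_of_le (by linarith [hε.1])]
    exact hF.comp (by fun_prop) fun y hy => left_mem_slitStrip hδ hε hy
  · refine Integrable.mono' hint (ContinuousOn.aestronglyMeasurable (hF.comp (by fun_prop)
      fun x hx => lower_mem_slitStrip hδ hε (le_of_lt hx)) measurableSet_Ioi) ?_
    filter_upwards [ae_restrict_mem measurableSet_Ioi] with x hx
    have := hK (x - I * ε) (by simp; linarith [mem_Ioi.1 hx, hδ.2]) (by simpa using h1)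
      (by simpa using le_abs_self ε)
    simpa using this

/-- The centre lies on the axis behind the origin, so the removed ray points straight away from it
and hides no other point. Hence holomorphic functions on the slit strip have primitives. -/
theorem starConvex_slitStrip (hη : 0 < η) :
    StarConvex ℝ (exp (I * α) * ((-(η / 2) : ℝ) : ℂ)) (slitStrip α η) := by
  intro ξ hξ a b ha hb hab
  obtain ⟨z, rfl⟩ : ∃ z, exp (I * α) * z = ξ := ⟨_, exp_I_mul_cancel_left α ξ⟩
  rw [exp_mul_mem_slitStrip_iff] at hξ
  rw [show a • (exp (I * α) * ((-(η / 2) : ℝ) : ℂ)) + b • (exp (I * α) * z) =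
    exp (I * α) * (a * ((-(η / 2) : ℝ) : ℂ) + b * z) by simp; ring, exp_mul_mem_slitStrip_iff]
  obtain ⟨⟨h1, h2⟩, h3⟩ := hξ
  have hre : (a * ((-(η / 2) : ℝ) : ℂ) + b * z).re = a * (-(η / 2)) + b * z.re := by
    rw [Complex.add_re, ← Complex.ofReal_mul, Complex.ofReal_re, Complex.re_ofReal_mul]
  have him : (a * ((-(η / 2) : ℝ) : ℂ) + b * z).im = b * z.im := by
    rw [Complex.add_im, ← Complex.ofReal_mul, Complex.ofReal_im, Complex.im_ofReal_mul, zero_add]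
  rw [hre, him]
  have hb1 : b = 1 - a := by linarith
  rcases hb.eq_or_lt with rfl | hb
  · have : a = 1 := by linarith
    subst this
    refine ⟨⟨by linarith, by simpa using hη⟩, Or.inl (by linarith)⟩
  · refine ⟨⟨?_, ?_⟩, ?_⟩
    · nlinarith
    · rw [abs_mul, abs_of_pos hb]
      nlinarith [abs_nonneg z.im]
    · rcases h3 with h3 | h3
      · left; nlinarith
      · right; exact mul_ne_zero hb.ne' h3

theorem tendsto_exp_neg_mul_atTop {κ : ℝ} (hκ : 0 < κ) (K : ℝ) :
    Tendsto (fun x : ℝ => K * Real.exp (-κ * x)) atTop (𝓝 0) := by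
  have := (Real.tendsto_exp_atBot.comp (tendsto_id.const_mul_atTop_of_neg (neg_lt_zero.2 hκ))).const_mul K
  simpa using this

theorem norm_sub_le_of_vertical {F G : ℂ → ℂ} {e : ℂ} (he : ‖e‖ = 1) {x y₁ y₂ M : ℝ}
    (hG : ∀ y ∈ uIcc y₁ y₂, HasDerivAt G (F (e * (x + I * y))) (e * (x + I * y)))
    (hM : ∀ y ∈ uIcc y₁ y₂, ‖F (e * (x + I * y))‖ ≤ M) :
    ‖G (e * (x + I * y₂)) - G (e * (x + I * y₁))‖ ≤ M * |y₂ - y₁| := by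
  have := (convex_uIcc y₁ y₂).norm_image_sub_le_of_norm_hasDerivWithin_le
    (f := fun y : ℝ => G (e * (x + I * y))) (C := M)
    (fun y hy => (hasDerivAt_line (hG y hy)).hasDerivWithinAt) (fun y hy => by
      rw [norm_mul, norm_mul, he, Complex.norm_I, mul_one, mul_one]
      exact hM y hy) left_mem_uIcc right_mem_uIcc
  simpa using this

/-- On one side of the ray the strip decay makes the integral over a vertical segment vanish at
infinity, so the limit of a primitive does not depend on the height. -/
theorem tendsto_sub_vertical {F G : ℂ → ℂ} (hd : HasStripDecay α η F)
    (hG : ∀ ξ ∈ slitStrip α η, HasDerivAt G (F ξ) ξ) {y₁ y₂ : ℝ} {m : ℝ} (hm : 0 < m)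
    (hy : ∀ y ∈ uIcc y₁ y₂, m ≤ |y| ∧ |y| < η) :
    Tendsto (fun x : ℝ => G (exp (I * α) * (x + I * y₂)) - G (exp (I * α) * (x + I * y₁))) atTop
      (𝓝 0) := by
  obtain ⟨K, κ, hκ, hK⟩ := hd m hm
  refine squeeze_zero_norm' (a := fun x => K * |y₂ - y₁| * Real.exp (-κ * x)) ?_
    (tendsto_exp_neg_mul_atTop hκ _)
  filter_upwards [eventually_ge_atTop 0] with x hx
  have hη : 0 < η := (abs_nonneg _).trans_lt (hy _ left_mem_uIcc).2
  refine (norm_sub_le_of_vertical (M := K * Real.exp (-κ * x)) (norm_exp_I_mul α)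
    (fun y hy' => hG _ ?_) (fun y hy' => ?_)).trans_eq (by ring)
  · rw [exp_mul_mem_slitStrip_iff]
    refine ⟨⟨by simp; linarith, by simpa using (hy y hy').2⟩, Or.inr ?_⟩
    have := hm.trans_le (hy y hy').1
    simpa using this
  · have := hK (x + I * y) (by simp; linarith) (by simpa using (hy y hy').2)
      (by simpa using (hy y hy').1)
    simpa using this

theorem exists_tendsto_ends {F G : ℂ → ℂ} (hd : HasStripDecay α η F)
    (hF : ContinuousOn F (slitStrip α η)) (hG : ∀ ξ ∈ slitStrip α η, HasDerivAt G (F ξ) ξ)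
    (hε : ε ∈ Ioo 0 η) :
    (∃ a, Tendsto (fun x : ℝ => G (exp (I * α) * (x + I * ε))) atTop (𝓝 a)) ∧
    ∃ b, Tendsto (fun x : ℝ => G (exp (I * α) * (x - I * ε))) atTop (𝓝 b) := by
  have hint := hd.hankelIntegrable hF hε hε
  constructor
  · refine ⟨_, tendsto_limUnder_of_hasDerivAt_of_integrableOn_Ioi (a := -ε)
      (f' := fun x : ℝ => F (exp (I * α) * (x + I * ε)) * exp (I * α)) (fun x hx => ?_)
      (Integrable.mul_const hint.1 _)⟩
    have := hG _ (upper_mem_slitStrip (α := α) hε hε (le_of_lt hx))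
    rw [show (x : ℂ) + I * ε = I * ε + 1 * x by ring] at this
    simpa [add_comm] using hasDerivAt_line this
  · refine ⟨_, tendsto_limUnder_of_hasDerivAt_of_integrableOn_Ioi (a := -ε)
      (f' := fun x : ℝ => F (exp (I * α) * (x - I * ε)) * exp (I * α)) (fun x hx => ?_)
      (Integrable.mul_const hint.2.2 _)⟩
    have := hG _ (lower_mem_slitStrip (α := α) hε hε (le_of_lt hx))
    rw [show (x : ℂ) - I * ε = -(I * ε) + 1 * x by ring] at this
    simpa [sub_eq_neg_add] using hasDerivAt_line this

/-- The Hankel integral of a decaying holomorphic function does not depend on the contour. -/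
theorem hankelIntegral_eq_hankelIntegral {F : ℂ → ℂ} (hd : HasStripDecay α η F)
    (hF : DifferentiableOn ℂ F (slitStrip α η)) {δ' ε' : ℝ} (hδ : δ ∈ Ioo 0 η) (hε : ε ∈ Ioo 0 η)
    (hδ' : δ' ∈ Ioo 0 η) (hε' : ε' ∈ Ioo 0 η) :
    hankelIntegral α δ ε F = hankelIntegral α δ' ε' F := by
  obtain ⟨G, hG⟩ := (starConvex_slitStrip (α := α) (hδ.1.trans hδ.2)).isExactOn
    (isOpen_slitStrip α η) hF
  obtain ⟨⟨a, ha⟩, b, hb⟩ := exists_tendsto_ends hd hF.continuousOn hG hε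
  obtain ⟨⟨a', ha'⟩, b', hb'⟩ := exists_tendsto_ends hd hF.continuousOn hG hε'
  rw [hankelIntegral_eq_of_hasDerivAt hδ hε (hd.hankelIntegrable hF.continuousOn hδ hε) hG ha hb,
    hankelIntegral_eq_of_hasDerivAt hδ' hε' (hd.hankelIntegrable hF.continuousOn hδ' hε') hG ha' hb']
  have hm : 0 < min ε ε' := lt_min hε.1 hε'.1
  have hM : max ε ε' < η := max_lt hε.2 hε'.2
  have h1 := tendsto_sub_vertical hd hG (y₁ := ε) (y₂ := ε') hm fun y hy => by
    rw [uIcc, mem_Icc] at hy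
    rw [abs_of_pos (hm.trans_le hy.1)]
    exact ⟨hy.1, hy.2.trans_lt hM⟩
  have h2 := tendsto_sub_vertical hd hG (y₁ := -ε) (y₂ := -ε') hm fun y hy => by
    rw [uIcc, mem_Icc, min_neg_neg, max_neg_neg] at hy
    rw [abs_of_neg (by linarith)]
    exact ⟨by linarith, by linarith⟩
  simp only [ofReal_neg, mul_neg, ← sub_eq_add_neg] at h2
  have h3 := tendsto_nhds_unique (ha'.sub ha) h1
  have h4 := tendsto_nhds_unique (hb'.sub hb) h2
  linear_combination h3 - h4

end contour

/-! ### Decay of the major Borel transform and the inversion formula. -/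

section

variable {α A η : ℝ} {h : ℂ → ℂ} {C : ℂ}

theorem exists_isBorelDir_strip {m : ℝ} {z : ℂ} (hz : m ≤ |z.im| ∨ z.re ≤ -m) :
    ∃ d, IsBorelDir α d ∧ m ≤ (d * (exp (I * α) * z)).re := by
  have key : ∀ v : ℂ, exp (-(I * α)) * v * (exp (I * α) * z) = v * z := fun v => by
    rw [mul_comm _ v, mul_assoc, exp_neg_I_mul_cancel_left]
  rcases hz with hz | hz
  · rcases le_total 0 z.im with h | h
    · rw [abs_of_nonneg h] at hz
      exact ⟨_, isBorelDir_exp_neg_mul (v := -I) (by simp) (by simp), by rw [key]; simpa using hz⟩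
    · rw [abs_of_nonpos h] at hz
      exact ⟨_, isBorelDir_exp_neg_mul (v := I) (by simp) (by simp), by rw [key]; simpa using hz⟩
  · exact ⟨_, isBorelDir_exp_neg_mul (v := -1) (by simp) (by simp),
      by rw [key]; simp; linarith⟩

/-- The factor `e^{-ξC}` from the base point of the rays carries all the behaviour along the strip,
with rate `Re (e^{iα} C)`; its transverse part costs at most `e^{η‖C‖}`. The margin `m` to the ray
controls the remaining Laplace integral, and the constant may blow up as `m → 0`. -/
theorem norm_majorBorel_strip_le (hh : DifferentiableOn ℂ h (borelHalfPlane α A))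
    (hs : IsSubexpOn (borelHalfPlane α A) h) (hC : C ∈ borelHalfPlane α A) {K m : ℝ} (hm : 0 < m)
    (hK : ∀ τ ∈ borelHalfPlane α A, ‖h τ‖ ≤ K * Real.exp (m / 2 * ‖τ‖)) {z : ℂ}
    (hz : m ≤ |z.im| ∨ z.re ≤ -m) (hη : |z.im| < η) :
    ‖majorBorel α C h (exp (I * α) * z)‖ ≤
      Real.exp (η * ‖C‖) * (K * Real.exp (m / 2 * ‖C‖)) * (2 / m) *
        Real.exp (-(exp (I * α) * C).re * z.re) := by
  obtain ⟨d, hd, hdz⟩ := exists_isBorelDir_strip (α := α) hz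
  refine (norm_majorBorel_le hh hs hC hd hm hK hdz).trans ?_
  have hK0 : 0 ≤ K * Real.exp (m / 2 * ‖C‖) := (norm_nonneg _).trans (hK C hC)
  have h1 : Real.exp (-(exp (I * α) * z * C).re) ≤
      Real.exp (η * ‖C‖) * Real.exp (-(exp (I * α) * C).re * z.re) := by
    rw [← Real.exp_add]
    gcongr
    have h2 : (exp (I * α) * z * C).re =
        (exp (I * α) * C).re * z.re - (exp (I * α) * C).im * z.im := by
      rw [mul_right_comm, Complex.mul_re]
    have h3 : |(exp (I * α) * C).im| ≤ ‖C‖ := by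
      refine (Complex.abs_im_le_norm _).trans ?_
      rw [norm_mul, norm_exp_I_mul, one_mul]
    have h4 : (exp (I * α) * C).im * z.im ≤ η * ‖C‖ := by
      calc _ ≤ |(exp (I * α) * C).im * z.im| := le_abs_self _
        _ = |z.im| * |(exp (I * α) * C).im| := by rw [abs_mul, mul_comm]
        _ ≤ η * ‖C‖ := mul_le_mul hη.le h3 (abs_nonneg _) ((abs_nonneg _).trans hη.le)
    rw [h2]; linarith
  calc _ ≤ (Real.exp (η * ‖C‖) * Real.exp (-(exp (I * α) * C).re * z.re)) *
        (K * Real.exp (m / 2 * ‖C‖)) * (2 / m) := by gcongr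
    _ = _ := by ring

theorem hasStripDecay_majorBorel (hh : DifferentiableOn ℂ h (borelHalfPlane α A))
    (hs : IsSubexpOn (borelHalfPlane α A) h) (hC : C ∈ borelHalfPlane α A)
    (hC₀ : 0 < (exp (I * α) * C).re) : HasStripDecay α η (majorBorel α C h) := by
  intro m hm
  obtain ⟨K, hK⟩ := hs (m / 2) (half_pos hm)
  exact ⟨_, _, hC₀, fun z _ h2 h3 => norm_majorBorel_strip_le hh hs hC hm hK (Or.inl h3) h2⟩

theorem hasStripDecay_majorBorel_mul_exp (hh : DifferentiableOn ℂ h (borelHalfPlane α A))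
    (hs : IsSubexpOn (borelHalfPlane α A) h) (hC : C ∈ borelHalfPlane α A) {w : ℂ}
    (hw : (exp (I * α) * w).re < (exp (I * α) * C).re) :
    HasStripDecay α η fun ξ => majorBorel α C h ξ * exp (ξ * w) := by
  intro m hm
  obtain ⟨K, hK⟩ := hs (m / 2) (half_pos hm)
  refine ⟨Real.exp (η * ‖C‖) * (K * Real.exp (m / 2 * ‖C‖)) * (2 / m) * Real.exp (η * ‖w‖),
    (exp (I * α) * C).re - (exp (I * α) * w).re, by linarith, fun z _ h2 h3 => ?_⟩
  have h4 := norm_majorBorel_strip_le hh hs hC hm hK (Or.inl h3) h2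
  have h5 : ‖exp (exp (I * α) * z * w)‖ ≤
      Real.exp (η * ‖w‖) * Real.exp ((exp (I * α) * w).re * z.re) := by
    rw [Complex.norm_exp, ← Real.exp_add]
    gcongr
    have h6 : |(exp (I * α) * w).im| ≤ ‖w‖ := by
      refine (Complex.abs_im_le_norm _).trans ?_
      rw [norm_mul, norm_exp_I_mul, one_mul]
    have h7 : -(η * ‖w‖) ≤ (exp (I * α) * w).im * z.im := by
      refine neg_le_of_neg_le ?_
      calc _ ≤ |(exp (I * α) * w).im * z.im| := neg_le_abs _
        _ = |z.im| * |(exp (I * α) * w).im| := by rw [abs_mul, mul_comm]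
        _ ≤ η * ‖w‖ := mul_le_mul h2.le h6 (abs_nonneg _) ((abs_nonneg _).trans h2.le)
    rw [mul_right_comm, Complex.mul_re]; linarith
  rw [norm_mul]
  refine (mul_le_mul h4 h5 (norm_nonneg _) ((norm_nonneg _).trans h4)).trans_eq ?_
  rw [show -((exp (I * α) * C).re - (exp (I * α) * w).re) * z.re =
    -(exp (I * α) * C).re * z.re + (exp (I * α) * w).re * z.re by ring, Real.exp_add]
  ring

/-- On a small closed ball around `w` compactness bounds the slope; outside it the denominator is at
least the radius. -/
theorem IsSubexpOn.dslope {P : Set ℂ} (hP : IsOpen P) (hh : DifferentiableOn ℂ h P)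
    (hs : IsSubexpOn P h) {w : ℂ} (hw : w ∈ P) : IsSubexpOn P (dslope h w) := by
  obtain ⟨r, hr, hrP⟩ := Metric.nhds_basis_closedBall.mem_iff.1 (hP.mem_nhds hw)
  have hc : ContinuousOn (_root_.dslope h w) P :=
    ((differentiableOn_dslope (hP.mem_nhds hw)).2 hh).continuousOn
  obtain ⟨M, hM⟩ := (isCompact_closedBall w r).exists_bound_of_continuousOn (hc.mono hrP)
  intro ε hε
  obtain ⟨K, hK⟩ := (hs.add (isSubexpOn_const P (-h w))) ε hε
  have hM0 : 0 ≤ M := (norm_nonneg _).trans (hM w (Metric.mem_closedBall_self hr.le))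
  refine ⟨M + K / r, fun τ hτ => ?_⟩
  have hK0 : 0 ≤ K * Real.exp (ε * ‖τ‖) := (norm_nonneg _).trans (hK τ hτ)
  have h1 : 1 ≤ Real.exp (ε * ‖τ‖) := Real.one_le_exp (by positivity)
  rw [add_mul]
  by_cases hτr : τ ∈ Metric.closedBall w r
  · refine (hM τ hτr).trans ?_
    have : 0 ≤ K / r * Real.exp (ε * ‖τ‖) := by
      rw [div_mul_eq_mul_div]; positivity
    nlinarith
  · rw [Metric.mem_closedBall, not_le, dist_eq_norm] at hτr
    have hne : τ ≠ w := by rintro rfl; simp at hτr; linarith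
    rw [dslope_of_ne _ hne, slope_def_field, norm_div, sub_eq_add_neg (h τ)]
    have h2 : ‖h τ + -h w‖ / ‖τ - w‖ ≤ K * Real.exp (ε * ‖τ‖) / r :=
      div_le_div₀ hK0 (hK τ hτ) hr hτr.le
    have h3 : 0 ≤ M * Real.exp (ε * ‖τ‖) := by positivity
    rw [div_mul_eq_mul_div]
    linarith

/-- Dividing by `x` cancels the common `log x`, and the two arguments then tend to `-1` from above
and from below the cut, where the logarithm has limits `πi` and `-πi`. -/
theorem tendsto_log_sub_log_across_cut {ε : ℝ} (hε : 0 < ε) :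
    Tendsto (fun x : ℝ => log (-(x - I * ε)) - log (-(x + I * ε))) atTop
      (𝓝 (2 * Real.pi * I)) := by
  have h0 : Tendsto (fun x : ℝ => I * ((ε / x : ℝ) : ℂ)) atTop (𝓝 0) := by
    have := (Complex.continuous_ofReal.tendsto _).comp
      ((tendsto_const_nhds (x := ε)).div_atTop tendsto_id)
    simpa using this.const_mul I
  have hU : Tendsto (fun x : ℝ => log (-1 + I * ((ε / x : ℝ) : ℂ))) atTop (𝓝 (Real.pi * I)) := by
    have h1 := tendsto_log_nhdsWithin_im_nonneg_of_re_neg_of_im_zero (z := -1) (by simp) (by simp)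
    simp only [norm_neg, norm_one, Real.log_one, ofReal_zero, zero_add] at h1
    refine h1.comp (tendsto_nhdsWithin_iff.2 ⟨by simpa using h0.const_add (-1), ?_⟩)
    filter_upwards [eventually_gt_atTop 0] with x hx
    simp only [add_im, neg_im, one_im, neg_zero, zero_add, I_mul_im, ofReal_re]
    positivity
  have hL : Tendsto (fun x : ℝ => log (-1 - I * ((ε / x : ℝ) : ℂ))) atTop
      (𝓝 (-(Real.pi * I))) := by
    have h1 := tendsto_log_nhdsWithin_im_neg_of_re_neg_of_im_zero (z := -1) (by simp) (by simp)
    simp only [norm_neg, norm_one, Real.log_one, ofReal_zero, zero_sub] at h1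
    refine h1.comp (tendsto_nhdsWithin_iff.2 ⟨by simpa using h0.const_sub (-1), ?_⟩)
    filter_upwards [eventually_gt_atTop 0] with x hx
    simp only [sub_im, neg_im, one_im, neg_zero, zero_sub, I_mul_im, ofReal_re,
      neg_lt_zero]
    positivity
  have h2 := hU.sub hL
  rw [show (Real.pi * I : ℂ) - -(Real.pi * I) = 2 * Real.pi * I by ring] at h2
  refine h2.congr' ?_
  filter_upwards [eventually_gt_atTop 0] with x hx
  have hx' : (x : ℂ) ≠ 0 := by exact_mod_cast hx.ne'
  have e1 : -((x : ℂ) - I * ε) = x * (-1 + I * ((ε / x : ℝ) : ℂ)) := by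
    push_cast; field_simp; ring
  have e2 : -((x : ℂ) + I * ε) = x * (-1 - I * ((ε / x : ℝ) : ℂ)) := by
    push_cast; field_simp; ring
  have n1 : (-1 + I * ((ε / x : ℝ) : ℂ)) ≠ 0 := fun h => by simpa using congrArg re h
  have n2 : (-1 - I * ((ε / x : ℝ) : ℂ)) ≠ 0 := fun h => by simpa using congrArg re h
  rw [e1, e2, Complex.log_ofReal_mul hx n1, Complex.log_ofReal_mul hx n2]
  ring

theorem hasDerivAt_log_neg_ray {ξ : ℂ} (hξ : ξ ∈ raySlitPlane α) :
    HasDerivAt (fun ξ => log (-(exp (-(I * α)) * ξ))) (1 / ξ) ξ := by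
  have h1 : HasDerivAt (fun ξ : ℂ => -(exp (-(I * α)) * ξ)) (-(exp (-(I * α)) * 1)) ξ :=
    ((hasDerivAt_id ξ).const_mul _).neg
  refine (h1.clog hξ).congr_deriv ?_
  have h2 : ξ ≠ 0 := by
    rintro rfl
    simp [raySlitPlane] at hξ
  have h3 := Complex.exp_ne_zero (-(I * α))
  field_simp

/-- The Hankel integral of `e^{-κ ξ} / ξ`. -/
theorem hankelIntegral_exp_div {δ ε : ℝ} (hδ : δ ∈ Ioo 0 η) (hε : ε ∈ Ioo 0 η) {κ : ℂ}
    (hκ : 0 < (exp (I * α) * κ).re) :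
    hankelIntegral α δ ε (fun ξ => exp (-(κ * ξ)) / ξ) = 2 * Real.pi * I := by
  have hne : ∀ ξ ∈ raySlitPlane α, ξ ≠ 0 := by
    rintro _ hξ rfl
    simp [raySlitPlane] at hξ
  have hnorm : ∀ z : ℂ, |z.im| < η →
      ‖exp (-(κ * (exp (I * α) * z)))‖ ≤
        Real.exp (η * ‖κ‖) * Real.exp (-(exp (I * α) * κ).re * z.re) := by
    intro z hz
    rw [Complex.norm_exp, ← Real.exp_add]
    gcongr
    have h6 : |(exp (I * α) * κ).im| ≤ ‖κ‖ := by
      refine (Complex.abs_im_le_norm _).trans ?_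
      rw [norm_mul, norm_exp_I_mul, one_mul]
    have h7 : (exp (I * α) * κ).im * z.im ≤ η * ‖κ‖ := by
      calc _ ≤ |(exp (I * α) * κ).im * z.im| := le_abs_self _
        _ = |z.im| * |(exp (I * α) * κ).im| := by rw [abs_mul, mul_comm]
        _ ≤ η * ‖κ‖ := mul_le_mul hz.le h6 (abs_nonneg _) ((abs_nonneg _).trans hz.le)
    rw [show κ * (exp (I * α) * z) = exp (I * α) * κ * z by ring, Complex.neg_re, Complex.mul_re]
    linarith
  have hd : HasStripDecay α η fun ξ => exp (-(κ * ξ)) / ξ := by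
    intro m hm
    refine ⟨Real.exp (η * ‖κ‖) / m, _, hκ, fun z _ h2 h3 => ?_⟩
    rw [norm_div, norm_mul (exp (I * α)) z, norm_exp_I_mul, one_mul, div_mul_eq_mul_div]
    exact div_le_div₀ (by positivity) (hnorm z h2) hm (h3.trans (Complex.abs_im_le_norm z))
  have hcont : ContinuousOn (fun ξ => exp (-(κ * ξ)) / ξ) (slitStrip α η) :=
    ContinuousOn.div (by fun_prop) continuousOn_id fun ξ hξ => hne ξ hξ.2
  -- `e^{-κξ}/ξ` is `1/ξ` plus the entire function `E = (e^{-κξ} - 1)/ξ`. A primitive is therefore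
  -- an entire function plus a logarithm cut along the ray, and only the logarithm jumps.
  let E : ℂ → ℂ := dslope (fun ξ => exp (-(κ * ξ))) 0
  have hE : Differentiable ℂ E := by
    rw [← differentiableOn_univ]
    refine (differentiableOn_dslope univ_mem).2 (Differentiable.differentiableOn (by fun_prop))
  have hEeq : ∀ ξ ≠ 0, E ξ = (exp (-(κ * ξ)) - 1) / ξ := by
    intro ξ hξ
    simp [E, dslope_of_ne _ hξ, slope_def_field]
  obtain ⟨Pr, hPr⟩ := hE.isExactOn_univ
  have hG : ∀ ξ ∈ slitStrip α η,
      HasDerivAt (fun ξ => Pr ξ + log (-(exp (-(I * α)) * ξ))) (exp (-(κ * ξ)) / ξ) ξ := by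
    intro ξ hξ
    refine ((hPr ξ (mem_univ _)).add (hasDerivAt_log_neg_ray hξ.2)).congr_deriv ?_
    rw [hEeq ξ (hne ξ hξ.2)]
    ring
  obtain ⟨⟨a, ha⟩, b, hb⟩ := exists_tendsto_ends hd hcont hG hε
  rw [hankelIntegral_eq_of_hasDerivAt hδ hε (hd.hankelIntegrable hcont hδ hε) hG ha hb]
  refine tendsto_nhds_unique (hb.sub ha) ?_
  -- Across the strip the entire part varies by `O(1/x)`: between heights `ε` and `-ε` its
  -- derivative `E` is `O(1/x)`.
  have h1 : Tendsto (fun x : ℝ => Pr (exp (I * α) * (x + I * (-ε : ℝ))) -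
      Pr (exp (I * α) * (x + I * ε))) atTop (𝓝 0) := by
    refine squeeze_zero_norm' (a := fun x => (Real.exp (η * ‖κ‖) + 1) * |-ε - ε| / x) ?_
      (tendsto_const_nhds.div_atTop tendsto_id)
    filter_upwards [eventually_gt_atTop 0] with x hx
    refine (norm_sub_le_of_vertical (M := (Real.exp (η * ‖κ‖) + 1) / x) (norm_exp_I_mul α)
      (fun y _ => hPr _ (mem_univ _)) (fun y hy => ?_)).trans_eq (by ring)
    rw [uIcc_neg_self hε.1] at hy
    have hx1 : x ≤ ‖exp (I * α) * ((x : ℂ) + I * y)‖ := by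
      rw [norm_mul, norm_exp_I_mul, one_mul]
      have := Complex.re_le_norm ((x : ℂ) + I * y)
      simpa using this
    have hx0 : exp (I * α) * ((x : ℂ) + I * y) ≠ 0 := norm_pos_iff.1 (hx.trans_le hx1)
    rw [hEeq _ hx0, norm_div]
    refine div_le_div₀ (by positivity) ?_ hx hx1
    refine (norm_sub_le _ _).trans ?_
    rw [norm_one]
    gcongr
    refine (hnorm _ (by simpa using (abs_le.2 hy).trans_lt hε.2)).trans ?_
    refine mul_le_of_le_one_right (Real.exp_pos _).le (Real.exp_le_one_iff.2 ?_)
    simp only [add_re, ofReal_re, I_mul_re, ofReal_im, neg_zero, add_zero]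
    nlinarith
  have h2 := h1.add (tendsto_log_sub_log_across_cut hε.1)
  rw [zero_add] at h2
  refine h2.congr fun x => ?_
  simp only [exp_neg_I_mul_cancel_left]
  push_cast
  rw [mul_neg, ← sub_eq_add_neg]
  ring

/-- Inversion of the major Borel transform. -/
theorem hankelIntegral_majorBorel_mul_exp {δ ε : ℝ} (hδ : δ ∈ Ioo 0 η) (hε : ε ∈ Ioo 0 η)
    (hh : DifferentiableOn ℂ h (borelHalfPlane α A)) (hs : IsSubexpOn (borelHalfPlane α A) h)
    (hC : C ∈ borelHalfPlane α A) {w : ℂ}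
    (hw : (exp (I * α) * w).re < (exp (I * α) * C).re) :
    HankelIntegrable α δ ε (fun ξ => majorBorel α C h ξ * exp (ξ * w)) ∧
    hankelIntegral α δ ε (fun ξ => majorBorel α C h ξ * exp (ξ * w)) = h w := by
  have hwP : w ∈ borelHalfPlane α A := hw.trans hC
  have hPo := isOpen_borelHalfPlane α A
  have hint : ∀ g : ℂ → ℂ, DifferentiableOn ℂ g (borelHalfPlane α A) →
      IsSubexpOn (borelHalfPlane α A) g →
      HankelIntegrable α δ ε (fun ξ => majorBorel α C g ξ * exp (ξ * w)) := by
    intro g hg hgs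
    refine (hasStripDecay_majorBorel_mul_exp hg hgs hC hw).hankelIntegrable ?_ hδ hε
    refine ContinuousOn.mul (fun ξ hξ => ?_) (by fun_prop)
    exact (hasDerivAt_majorBorel hg hgs hC hξ.2).continuousAt.continuousWithinAt
  refine ⟨hint h hh hs, ?_⟩
  -- The decomposition `h = h(w) + (τ - w) g`; `g` is again holomorphic and subexponential, so it
  -- has a major Borel transform too.
  let g : ℂ → ℂ := dslope h w
  have hg : DifferentiableOn ℂ g (borelHalfPlane α A) :=
    (differentiableOn_dslope (hPo.mem_nhds hwP)).2 hh
  have hgs : IsSubexpOn (borelHalfPlane α A) g := hs.dslope hPo hh hwP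
  have h1s := isSubexpOn_const (borelHalfPlane α A) 1
  have hτg : DifferentiableOn ℂ (fun τ => τ * g τ) (borelHalfPlane α A) := differentiableOn_id.mul hg
  have hwg : DifferentiableOn ℂ (fun τ => -w * g τ) (borelHalfPlane α A) := hg.const_mul _
  have hdec : h = fun τ => h w * 1 + (τ * g τ + -w * g τ) := by
    ext τ
    have := sub_smul_dslope h w τ
    rw [smul_eq_mul] at this
    linear_combination -this
  have hF : EqOn (fun ξ => majorBorel α C h ξ * exp (ξ * w)) (fun ξ =>
      h w * (majorBorel α C (fun _ => 1) ξ * exp (ξ * w)) +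
        majorBorel α C (fun τ => τ * g τ + -w * g τ) ξ * exp (ξ * w)) (slitStrip α η) := by
    intro ξ hξ
    have := majorBorel_add (h₁ := fun _ => h w * 1) (h₂ := fun τ => τ * g τ + -w * g τ)
      (differentiableOn_const _) (hτg.add hwg)
      (h1s.const_mul (h w)) (hgs.id_mul.add (hgs.const_mul _)) hC hξ.2
    rw [← hdec, majorBorel_const_mul (fun _ => 1)] at this
    simp only [this]
    ring
  have hint1 := hint (fun _ => 1) (differentiableOn_const _) h1s
  have hint2 := hint (fun τ => τ * g τ + -w * g τ) (hτg.add hwg)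
    (hgs.id_mul.add (hgs.const_mul _))
  rw [hankelIntegral_congr hδ hε hF, hankelIntegral_add (hint1.const_mul _) hint2,
    hankelIntegral_const_mul]
  have hzero : hankelIntegral α δ ε
      (fun ξ => majorBorel α C (fun τ => τ * g τ + -w * g τ) ξ * exp (ξ * w)) = 0 := by
    -- The transform of `(τ - w) g` times `e^{ξw}` is minus the derivative of the transform of `g`
    -- times `e^{ξw}`, and this primitive tends to zero at both ends of the contour.
    have hG : ∀ ξ ∈ slitStrip α η, HasDerivAt (fun ξ => -(majorBorel α C g ξ * exp (ξ * w)))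
        (majorBorel α C (fun τ => τ * g τ + -w * g τ) ξ * exp (ξ * w)) ξ := by
      intro ξ hξ
      have e1 : HasDerivAt (fun ξ : ℂ => ξ * w) (1 * w) ξ := (hasDerivAt_id ξ).mul_const w
      refine ((hasDerivAt_majorBorel hg hgs hC hξ.2).mul e1.cexp).neg.congr_deriv ?_
      rw [majorBorel_add hτg hwg hgs.id_mul (hgs.const_mul _) hC hξ.2, majorBorel_const_mul]
      ring
    have hlim := hasStripDecay_majorBorel_mul_exp (η := η) hg hgs hC hw ε hε.1
    obtain ⟨K, κ, hκ, hK⟩ := hlim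
    have hεη : |ε| < η := by rw [abs_of_pos hε.1]; exact hε.2
    have ha : Tendsto (fun x : ℝ => -(majorBorel α C g (exp (I * α) * (x + I * ε)) *
        exp (exp (I * α) * (x + I * ε) * w))) atTop (𝓝 0) := by
      refine squeeze_zero_norm' ?_ (tendsto_exp_neg_mul_atTop hκ K)
      filter_upwards [eventually_ge_atTop 0] with x hx
      rw [norm_neg]
      have := hK (x + I * ε) (by simp; linarith [hε.1, hε.2]) (by simpa using hεη)
        (by simpa using le_abs_self ε)
      simpa using this
    have hb : Tendsto (fun x : ℝ => -(majorBorel α C g (exp (I * α) * (x - I * ε)) *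
        exp (exp (I * α) * (x - I * ε) * w))) atTop (𝓝 0) := by
      refine squeeze_zero_norm' ?_ (tendsto_exp_neg_mul_atTop hκ K)
      filter_upwards [eventually_ge_atTop 0] with x hx
      rw [norm_neg]
      have := hK (x - I * ε) (by simp; linarith [hε.1, hε.2]) (by simpa using hεη)
        (by simpa using le_abs_self ε)
      simpa using this
    rw [hankelIntegral_eq_of_hasDerivAt hδ hε hint2 hG ha hb, sub_self]
  have hone : hankelIntegral α δ ε (fun ξ => majorBorel α C (fun _ => 1) ξ * exp (ξ * w)) = 1 := by
    have e1 : EqOn (fun ξ => majorBorel α C (fun _ => 1) ξ * exp (ξ * w))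
        (fun ξ => 1 / (2 * Real.pi * I) * (exp (-((C - w) * ξ)) / ξ)) (slitStrip α η) := by
      intro ξ hξ
      simp only [majorBorel_one hC hξ.2]
      rw [show -((C - w) * ξ) = -(ξ * C) + ξ * w by ring, Complex.exp_add]
      ring
    rw [hankelIntegral_congr hδ hε e1, hankelIntegral_const_mul,
      hankelIntegral_exp_div hδ hε (by rw [mul_sub, Complex.sub_re]; linarith),
      one_div, inv_mul_cancel₀ Complex.two_pi_I_ne_zero]
  rw [hzero, hone, mul_one, add_zero]

end

/-! ### The kernel, its poles, and the Hankel representation as a function of `s`. -/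

/-- `1 - e^{ξ - s}` stays away from `0` on the half-strip of half-width `η` around
`e^{iα} ℝ≥0`. -/
def IsPoleFreeStrip (α : ℝ) (s : ℂ) (η : ℝ) : Prop :=
  0 < η ∧ ∃ b > 0, ∀ z : ℂ, -η < z.re → |z.im| < η → b ≤ ‖1 - exp (exp (I * α) * z - s)‖

theorem IsPoleFreeStrip.mono {α : ℝ} {s : ℂ} {η η' : ℝ} (h : IsPoleFreeStrip α s η) (h0 : 0 < η')
    (hle : η' ≤ η) : IsPoleFreeStrip α s η' := by
  obtain ⟨_, b, hb, hz⟩ := h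
  exact ⟨h0, b, hb, fun z h1 h2 => hz z (by linarith) (h2.trans_le hle)⟩

theorem exp_I_mul_re (α : ℝ) : (exp (I * α)).re = Real.cos α := by
  rw [mul_comm]; exact Complex.exp_ofReal_mul_I_re α

/-- Zeros on the ray are excluded by the slit condition on `s`, and since `cos α < 0` the
exponential dies along the ray, so the modulus tends to `1`. Only a compact segment remains. -/
theorem exists_pos_le_norm_one_sub_exp_ray {α : ℝ} (hα : Real.cos α < 0) {s : ℂ}
    (hs : s ∈ thetaSlitPlane α) :
    ∃ b > 0, ∀ r : ℝ, 0 ≤ r → b ≤ ‖1 - exp (exp (I * α) * r - s)‖ := by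
  have hpos : ∀ r : ℝ, 0 ≤ r → 0 < ‖1 - exp (exp (I * α) * r - s)‖ := by
    intro r hr
    rw [norm_pos_iff, sub_ne_zero]
    intro h
    obtain ⟨n, hn⟩ := Complex.exp_eq_one_iff.1 h.symm
    refine hs (-n) r hr ?_
    push_cast
    linear_combination -hn
  have hcont : Continuous fun r : ℝ => ‖1 - exp (exp (I * α) * r - s)‖ := by fun_prop
  have hlim : Tendsto (fun r : ℝ => ‖1 - exp (exp (I * α) * r - s)‖) atTop (𝓝 1) := by
    have h0 : Tendsto (fun r : ℝ => exp (exp (I * α) * r - s)) atTop (𝓝 0) := by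
      rw [Complex.tendsto_exp_nhds_zero_iff]
      simp only [Complex.sub_re, Complex.re_mul_ofReal, exp_I_mul_re]
      exact tendsto_atBot_add_const_right _ _ (tendsto_id.const_mul_atTop_of_neg hα)
    simpa using (h0.const_sub 1).norm
  obtain ⟨R, hR⟩ := eventually_atTop.1 (hlim.eventually (lt_mem_nhds (one_half_lt_one (α := ℝ))))
  obtain ⟨r₀, hr₀, hmin⟩ := (isCompact_Icc (a := (0 : ℝ)) (b := max R 0)).exists_isMinOn
    ⟨0, by simp⟩ hcont.continuousOn
  refine ⟨min (1 / 2) ‖1 - exp (exp (I * α) * r₀ - s)‖, lt_min (by norm_num) (hpos _ hr₀.1),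
    fun r hr => ?_⟩
  by_cases hrR : r ≤ max R 0
  · exact (min_le_right _ _).trans (hmin ⟨hr, hrR⟩)
  · exact (min_le_left _ _).trans (hR r ((le_max_left _ _).trans (not_le.1 hrR).le)).le

theorem exists_isPoleFreeStrip {α : ℝ} (hα : Real.cos α < 0) {s : ℂ}
    (hs : s ∈ thetaSlitPlane α) :
    ∃ η > 0, ∃ b > 0, ∃ ρ > 0, ∀ s' ∈ Metric.ball s ρ, ∀ z : ℂ, -η < z.re → |z.im| < η →
      b ≤ ‖1 - exp (exp (I * α) * z - s')‖ := by
  obtain ⟨b, hb, hray⟩ := exists_pos_le_norm_one_sub_exp_ray hα hs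
  set M := Real.exp (-s.re) with hM
  have hM0 : 0 < M := Real.exp_pos _
  have hexp : ∀ᶠ q in 𝓝 (0 : ℂ), ‖exp q - 1‖ < b / (2 * M) := by
    have : Tendsto (fun q : ℂ => ‖exp q - 1‖) (𝓝 0) (𝓝 0) := by
      have h : Continuous fun q : ℂ => ‖exp q - 1‖ := by fun_prop
      simpa using h.tendsto 0
    exact this.eventually (gt_mem_nhds (by positivity))
  obtain ⟨κ, hκ, hball⟩ := Metric.eventually_nhds_iff.1 hexp
  -- The real defect, the imaginary part and the shift of `s` each contribute less than `κ / 4` to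
  -- the perturbation `q`. The ball around `s` makes the bound uniform in `s`, as holomorphy in `s`
  -- requires.
  refine ⟨κ / 4, by positivity, b / 2, by positivity, κ / 4, by positivity,
    fun s' hs' z hre him => ?_⟩
  set r := max z.re 0 with hr
  have hzr : ‖z - r‖ < κ / 2 := by
    refine (Complex.norm_le_abs_re_add_abs_im _).trans_lt ?_
    have h1 : |(z - r).re| < κ / 4 := by
      rw [Complex.sub_re, Complex.ofReal_re, hr]
      rcases le_total z.re 0 with h | h
      · rw [max_eq_right h, sub_zero, abs_of_nonpos h]; linarith
      · rw [max_eq_left h, sub_self, abs_zero]; positivity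
    have h2 : |(z - r).im| < κ / 4 := by simpa using him
    linarith
  set q := exp (I * α) * (z - r) + (s - s') with hq
  have hqn : ‖q‖ < κ := by
    refine (norm_add_le _ _).trans_lt ?_
    rw [norm_mul, norm_exp_I_mul, one_mul, ← dist_eq_norm s, dist_comm]
    rw [Metric.mem_ball] at hs'
    linarith
  have h3 := hball (y := q) (by simpa using hqn)
  have h4 := hray r (le_max_right _ _)
  have h5 : ‖exp (exp (I * α) * r - s)‖ ≤ M := by
    rw [Complex.norm_exp, Complex.sub_re, Complex.re_mul_ofReal, exp_I_mul_re, hM]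
    gcongr
    nlinarith [le_max_right z.re 0]
  have h6 : 1 - exp (exp (I * α) * z - s') =
      (1 - exp (exp (I * α) * r - s)) - exp (exp (I * α) * r - s) * (exp q - 1) := by
    rw [show exp (I * α) * z - s' = (exp (I * α) * r - s) + q by rw [hq]; ring, Complex.exp_add]
    ring
  have h7 : ‖exp (exp (I * α) * r - s) * (exp q - 1)‖ ≤ b / 2 := by
    rw [norm_mul]
    calc _ ≤ M * (b / (2 * M)) := mul_le_mul h5 h3.le (norm_nonneg _) hM0.le
      _ = b / 2 := by field_simp
  rw [h6]
  linarith [norm_sub_norm_le (1 - exp (exp (I * α) * r - s))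
    (exp (exp (I * α) * r - s) * (exp q - 1))]

/-- `u` grows on `P` more slowly than every positive multiple of `‖τ‖`. -/
def IsSublinearOn (P : Set ℂ) (u : ℂ → ℂ) : Prop :=
  ∀ ε > 0, ∃ K : ℝ, ∀ τ ∈ P, ‖u τ‖ ≤ ε * ‖τ‖ + K

/-- The slope `ε / (S + 1)` leaves a rate at most `ε` after multiplication by `‖s‖ ≤ S`. The
constant is uniform in such `s`, which provides the dominating functions for holomorphy in the
parameter. -/
theorem IsSublinearOn.exists_exp_bound {P : Set ℂ} {u : ℂ → ℂ} (hu : IsSublinearOn P u) {S : ℝ}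
    (hS : 0 ≤ S) {ε : ℝ} (hε : 0 < ε) :
    ∃ K : ℝ, ∀ s : ℂ, ‖s‖ ≤ S → ∀ τ ∈ P, ‖exp (-(s * u τ))‖ ≤ K * Real.exp (ε * ‖τ‖) := by
  obtain ⟨K, hK⟩ := hu (ε / (S + 1)) (by positivity)
  refine ⟨Real.exp (S * K), fun s hs τ hτ => ?_⟩
  rw [Complex.norm_exp, ← Real.exp_add]
  gcongr
  have h1 : (-(s * u τ)).re ≤ ‖s‖ * ‖u τ‖ := by
    refine (Complex.re_le_norm _).trans ?_
    rw [norm_neg, norm_mul]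
  have h2 : S * (ε / (S + 1)) ≤ ε := by
    rw [mul_div_assoc', div_le_iff₀ (by positivity)]
    nlinarith
  calc _ ≤ ‖s‖ * ‖u τ‖ := h1
    _ ≤ S * (ε / (S + 1) * ‖τ‖ + K) := mul_le_mul hs (hK τ hτ) (norm_nonneg _) hS
    _ = S * (ε / (S + 1)) * ‖τ‖ + S * K := by ring
    _ ≤ ε * ‖τ‖ + S * K := by gcongr
    _ = _ := add_comm _ _

theorem IsSublinearOn.isSubexpOn {P : Set ℂ} {u : ℂ → ℂ} (hu : IsSublinearOn P u) (s : ℂ) :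
    IsSubexpOn P fun τ => exp (-(s * u τ)) := by
  intro ε hε
  obtain ⟨K, hK⟩ := hu.exists_exp_bound (norm_nonneg s) hε
  exact ⟨K, hK s le_rfl⟩

/-- The integrand of the Hankel representation of the theta function. -/
noncomputable def thetaIntegrand (α : ℝ) (C : ℂ) (u : ℂ → ℂ) (s ξ : ℂ) : ℂ :=
  majorBorel α C (fun τ => exp (-(s * u τ))) ξ / (1 - exp (ξ - s))

/-- The Hankel representation of the theta function. -/
noncomputable def hankelTheta (α : ℝ) (C : ℂ) (u : ℂ → ℂ) (s : ℂ) : ℂ :=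
  open Classical in
  if H : ∃ η, IsPoleFreeStrip α s η then
    hankelIntegral α (H.choose / 2) (H.choose / 2) (thetaIntegrand α C u s) else 0

section

variable {α A : ℝ} {C : ℂ} {u : ℂ → ℂ}

theorem differentiableOn_exp_neg_mul (hd : DifferentiableOn ℂ u (borelHalfPlane α A)) (s : ℂ) :
    DifferentiableOn ℂ (fun τ => exp (-(s * u τ))) (borelHalfPlane α A) :=
  (hd.const_mul s).neg.cexp

theorem exists_norm_majorBorel_exp_le (hd : DifferentiableOn ℂ u (borelHalfPlane α A))
    (hu : IsSublinearOn (borelHalfPlane α A) u) (hC : C ∈ borelHalfPlane α A) {S m : ℝ}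
    (hS : 0 ≤ S) (hm : 0 < m) (η : ℝ) :
    ∃ K : ℝ, ∀ s : ℂ, ‖s‖ ≤ S → ∀ z : ℂ, (m ≤ |z.im| ∨ z.re ≤ -m) → |z.im| < η →
      ‖majorBorel α C (fun τ => exp (-(s * u τ))) (exp (I * α) * z)‖ ≤
        K * Real.exp (-(exp (I * α) * C).re * z.re) := by
  obtain ⟨K, hK⟩ := hu.exists_exp_bound hS (half_pos hm)
  exact ⟨_, fun s hs z hz hη => norm_majorBorel_strip_le (differentiableOn_exp_neg_mul hd s)
    (hu.isSubexpOn s) hC hm (hK s hs) hz hη⟩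

theorem differentiable_majorBorel_param (hd : DifferentiableOn ℂ u (borelHalfPlane α A))
    (hu : IsSublinearOn (borelHalfPlane α A) u) (hC : C ∈ borelHalfPlane α A) {ξ : ℂ}
    (hξ : ξ ∈ raySlitPlane α) :
    Differentiable ℂ fun s => majorBorel α C (fun τ => exp (-(s * u τ))) ξ := by
  obtain ⟨d, hdir, hdξ⟩ := exists_isBorelDir hξ
  intro s₀
  obtain ⟨K, hK⟩ := hu.exists_exp_bound (S := ‖s₀‖ + 1) (by positivity) (half_pos hdξ)
  have h1 : DifferentiableOn ℂ (fun s => rayLaplace (fun τ => exp (-(s * u τ))) C d ξ)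
      (Metric.ball s₀ 1) := by
    refine differentiableOn_integral_of_dominated Metric.isOpen_ball
      (bound := fun r => Real.exp (-(ξ * C).re) * (K * Real.exp ((d * ξ).re / 2 * ‖C‖)) *
        Real.exp (-((d * ξ).re / 2) * r))
      (fun s _ => aestronglyMeasurable_rayLaplace_integrand
        (differentiableOn_exp_neg_mul hd s).continuousOn hC hdir ξ)
      (Eventually.of_forall fun r => Differentiable.differentiableOn (by fun_prop)) ?_
      (integrableOn_exp_neg_half hdξ _)
    filter_upwards [ae_restrict_mem measurableSet_Ioi] with r hr s hs
    refine norm_rayLaplace_integrand_le (h := fun τ => exp (-(s * u τ))) hC hdir hdξ.le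
      (hK s ?_) le_rfl (mem_Ioi.1 hr).le
    rw [Metric.mem_ball, dist_eq_norm] at hs
    calc ‖s‖ = ‖s₀ + (s - s₀)‖ := by congr 1; ring
      _ ≤ _ := (norm_add_le _ _).trans (by linarith)
  have h2 := (h1.differentiableAt (Metric.ball_mem_nhds s₀ one_pos)).const_mul
    (1 / (2 * Real.pi * I))
  refine h2.congr_of_eventuallyEq (Eventually.of_forall fun s => ?_)
  exact majorBorel_eq (differentiableOn_exp_neg_mul hd s) (hu.isSubexpOn s) hC hdir hdξ

theorem IsPoleFreeStrip.ne_zero {s : ℂ} {η : ℝ} (hp : IsPoleFreeStrip α s η) {ξ : ℂ}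
    (hξ : ξ ∈ slitStrip α η) : 1 - exp (ξ - s) ≠ 0 := by
  obtain ⟨z, rfl⟩ : ∃ z, exp (I * α) * z = ξ := ⟨_, exp_I_mul_cancel_left α ξ⟩
  obtain ⟨_, b, hb, hz⟩ := hp
  rw [exp_mul_mem_slitStrip_iff] at hξ
  exact norm_pos_iff.1 (hb.trans_le (hz z hξ.1.1 hξ.1.2))

theorem differentiableOn_thetaIntegrand (hd : DifferentiableOn ℂ u (borelHalfPlane α A))
    (hu : IsSublinearOn (borelHalfPlane α A) u) (hC : C ∈ borelHalfPlane α A) {s : ℂ} {η : ℝ}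
    (hp : IsPoleFreeStrip α s η) :
    DifferentiableOn ℂ (thetaIntegrand α C u s) (slitStrip α η) := by
  intro ξ hξ
  exact ((hasDerivAt_majorBorel (differentiableOn_exp_neg_mul hd s) (hu.isSubexpOn s) hC
    hξ.2).differentiableAt.div (by fun_prop) (hp.ne_zero hξ)).differentiableWithinAt

theorem hasStripDecay_thetaIntegrand (hd : DifferentiableOn ℂ u (borelHalfPlane α A))
    (hu : IsSublinearOn (borelHalfPlane α A) u) (hC : C ∈ borelHalfPlane α A)
    (hC₀ : 0 < (exp (I * α) * C).re) {s : ℂ} {η : ℝ} (hp : IsPoleFreeStrip α s η) :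
    HasStripDecay α η (thetaIntegrand α C u s) := by
  intro m hm
  obtain ⟨_, b, hb, hz⟩ := hp
  obtain ⟨K, κ, hκ, hK⟩ := hasStripDecay_majorBorel (η := η) (differentiableOn_exp_neg_mul hd s)
    (hu.isSubexpOn s) hC hC₀ m hm
  refine ⟨K / b, κ, hκ, fun z h1 h2 h3 => ?_⟩
  have h4 := hK z h1 h2 h3
  rw [thetaIntegrand, norm_div, div_mul_eq_mul_div]
  exact div_le_div₀ ((norm_nonneg _).trans h4) h4 hb (hz z h1 h2)

theorem hankelIntegrable_thetaIntegrand (hd : DifferentiableOn ℂ u (borelHalfPlane α A))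
    (hu : IsSublinearOn (borelHalfPlane α A) u) (hC : C ∈ borelHalfPlane α A)
    (hC₀ : 0 < (exp (I * α) * C).re) {s : ℂ} {η δ ε : ℝ} (hp : IsPoleFreeStrip α s η)
    (hδ : δ ∈ Ioo 0 η) (hε : ε ∈ Ioo 0 η) : HankelIntegrable α δ ε (thetaIntegrand α C u s) :=
  (hasStripDecay_thetaIntegrand hd hu hC hC₀ hp).hankelIntegrable
    (differentiableOn_thetaIntegrand hd hu hC hp).continuousOn hδ hε

theorem hankelTheta_eq (hd : DifferentiableOn ℂ u (borelHalfPlane α A))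
    (hu : IsSublinearOn (borelHalfPlane α A) u) (hC : C ∈ borelHalfPlane α A)
    (hC₀ : 0 < (exp (I * α) * C).re) {s : ℂ} {η δ ε : ℝ} (hp : IsPoleFreeStrip α s η)
    (hδ : δ ∈ Ioo 0 η) (hε : ε ∈ Ioo 0 η) :
    hankelIntegral α δ ε (thetaIntegrand α C u s) = hankelTheta α C u s := by
  have H : ∃ η, IsPoleFreeStrip α s η := ⟨η, hp⟩
  rw [hankelTheta, dif_pos H]
  have hp' := H.choose_spec
  set η' := H.choose
  -- The given strip and the chosen one are compared through a contour that fits in both, so the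
  -- value does not depend on the choice in `hankelTheta`.
  have key : ∀ η₁, IsPoleFreeStrip α s η₁ → ∀ δ₁ ∈ Ioo 0 η₁, ∀ ε₁ ∈ Ioo 0 η₁, ∀ θ, 0 < θ → θ < η₁ →
      hankelIntegral α δ₁ ε₁ (thetaIntegrand α C u s) =
        hankelIntegral α θ θ (thetaIntegrand α C u s) := fun η₁ hp₁ δ₁ hδ₁ ε₁ hε₁ θ h0 h1 =>
    hankelIntegral_eq_hankelIntegral (hasStripDecay_thetaIntegrand hd hu hC hC₀ hp₁)
      (differentiableOn_thetaIntegrand hd hu hC hp₁) hδ₁ hε₁ ⟨h0, h1⟩ ⟨h0, h1⟩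
  have hη0 := hp.1
  have hη0' := hp'.1
  have hθ : 0 < min η η' := lt_min hη0 hη0'
  have hh : η' / 2 ∈ Ioo 0 η' := ⟨half_pos hη0', half_lt_self hη0'⟩
  rw [key η hp δ hδ ε hε (min η η' / 2) (half_pos hθ)
      ((half_lt_self hθ).trans_le (min_le_left _ _)),
    key η' hp' _ hh _ hh (min η η' / 2) (half_pos hθ)
      ((half_lt_self hθ).trans_le (min_le_right _ _))]

theorem differentiableOn_hankelTheta (hα : Real.cos α < 0)
    (hd : DifferentiableOn ℂ u (borelHalfPlane α A))
    (hu : IsSublinearOn (borelHalfPlane α A) u) (hC : C ∈ borelHalfPlane α A)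
    (hC₀ : 0 < (exp (I * α) * C).re) :
    DifferentiableOn ℂ (hankelTheta α C u) (thetaSlitPlane α) := by
  intro s₀ hs₀
  obtain ⟨η, hη, b, hb, ρ, hρ, hstrip⟩ := exists_isPoleFreeStrip hα hs₀
  have hp : ∀ s ∈ Metric.ball s₀ ρ, IsPoleFreeStrip α s η := fun s hs => ⟨hη, b, hb, hstrip s hs⟩
  have hh : η / 2 ∈ Ioo 0 η := ⟨half_pos hη, half_lt_self hη⟩
  set κ := (exp (I * α) * C).re with hκ
  obtain ⟨K, hK⟩ := exists_norm_majorBorel_exp_le hd hu hC (S := ‖s₀‖ + ρ) (by positivity)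
    (half_pos hη) η
  -- The fixed contour of sizes `η / 2` stays at distance at least `η / 2` from the ray: its long
  -- sides by the imaginary part, its short side by the real part. One exponential then dominates
  -- for all `s` near `s₀`.
  have hbound : ∀ s ∈ Metric.ball s₀ ρ, ∀ z : ℂ, -η < z.re → |z.im| < η →
      (η / 2 ≤ |z.im| ∨ z.re ≤ -(η / 2)) →
      ‖thetaIntegrand α C u s (exp (I * α) * z)‖ ≤ K / b * Real.exp (-κ * z.re) := by
    intro s hs z h1 h2 h3
    have hsn : ‖s‖ ≤ ‖s₀‖ + ρ := by
      rw [Metric.mem_ball, dist_eq_norm] at hs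
      calc ‖s‖ = ‖s₀ + (s - s₀)‖ := by congr 1; ring
        _ ≤ _ := (norm_add_le _ _).trans (by linarith)
    have h4 := hK s hsn z h3 h2
    rw [thetaIntegrand, norm_div, div_mul_eq_mul_div]
    exact div_le_div₀ ((norm_nonneg _).trans h4) h4 hb (hstrip s hs z h1 h2)
  have hdiff : ∀ ξ ∈ slitStrip α η,
      DifferentiableOn ℂ (fun s => thetaIntegrand α C u s ξ) (Metric.ball s₀ ρ) := by
    intro ξ hξ s hs
    exact (((differentiable_majorBorel_param hd hu hC hξ.2) s).div (by fun_prop)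
      ((hp s hs).ne_zero hξ)).differentiableWithinAt
  have hint := fun s hs => hankelIntegrable_thetaIntegrand hd hu hC hC₀ (hp s hs) hh hh
  have hηa : |η / 2| < η := by rw [abs_of_pos hh.1]; exact hh.2
  have hexp : IntegrableOn (fun x : ℝ => K / b * Real.exp (-κ * x)) (Ioi (-(η / 2))) :=
    (exp_neg_integrableOn_Ioi _ hC₀).const_mul _
  have hD : DifferentiableOn ℂ (fun s => hankelIntegral α (η / 2) (η / 2) (thetaIntegrand α C u s))
      (Metric.ball s₀ ρ) := by
    simp only [hankelIntegral, integral_mul_const, intervalIntegral.integral_mul_const]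
    refine DifferentiableOn.add (DifferentiableOn.add (DifferentiableOn.neg
      (DifferentiableOn.mul_const ?_ _)) (DifferentiableOn.mul_const ?_ _))
      (DifferentiableOn.mul_const ?_ _)
    · refine differentiableOn_integral_of_dominated Metric.isOpen_ball
        (fun s hs => (hint s hs).1.aestronglyMeasurable) ?_ ?_ hexp
      · filter_upwards [ae_restrict_mem measurableSet_Ioi] with x hx
        exact hdiff _ (upper_mem_slitStrip hh hh (le_of_lt hx))
      · filter_upwards [ae_restrict_mem measurableSet_Ioi] with x hx s hs
        have := hbound s hs (x + I * (η / 2 : ℝ)) (by simp; linarith [mem_Ioi.1 hx])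
          (by simpa using hηa) (Or.inl (by simpa using le_abs_self (η / 2)))
        simpa using this
    · simp only [intervalIntegral.integral_symm (-(η / 2)) (η / 2)]
      simp only [intervalIntegral.integral_of_le (show -(η / 2) ≤ η / 2 by linarith)]
      refine DifferentiableOn.neg ?_
      refine differentiableOn_integral_of_dominated Metric.isOpen_ball
        (bound := fun _ => K / b * Real.exp (-κ * -(η / 2)))
        (fun s hs => ((intervalIntegrable_iff_integrableOn_Ioc_of_le (by linarith)).1
          (hint s hs).2.1).aestronglyMeasurable) ?_ ?_ (integrable_const _)
      · filter_upwards [ae_restrict_mem measurableSet_Ioc] with y hy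
        exact hdiff _ (left_mem_slitStrip hh hh (Ioc_subset_Icc_self hy))
      · filter_upwards [ae_restrict_mem measurableSet_Ioc] with y hy s hs
        have := hbound s hs (-(η / 2 : ℝ) + I * y) (by simp; linarith)
          (by simpa using (abs_le.2 (Ioc_subset_Icc_self hy)).trans_lt hh.2) (Or.inr (by simp))
        simpa using this
    · refine differentiableOn_integral_of_dominated Metric.isOpen_ball
        (fun s hs => (hint s hs).2.2.aestronglyMeasurable) ?_ ?_ hexp
      · filter_upwards [ae_restrict_mem measurableSet_Ioi] with x hx
        exact hdiff _ (lower_mem_slitStrip hh hh (le_of_lt hx))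
      · filter_upwards [ae_restrict_mem measurableSet_Ioi] with x hx s hs
        have := hbound s hs (x - I * (η / 2 : ℝ)) (by simp; linarith [mem_Ioi.1 hx])
          (by simpa using hηa) (Or.inl (by simpa using le_abs_self (η / 2)))
        simpa using this
  refine ((hD.differentiableAt (Metric.ball_mem_nhds s₀ hρ)).congr_of_eventuallyEq
    ?_).differentiableWithinAt
  filter_upwards [Metric.ball_mem_nhds s₀ hρ] with s hs
  exact (hankelTheta_eq hd hu hC hC₀ (hp s hs) hh hh).symm

end

/-! ### The theta series and the boundary value integral. -/

section

variable {α A : ℝ} {C : ℂ} {u : ℂ → ℂ}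

theorem natCast_re_nonpos (hα : Real.cos α < 0) (n : ℕ) : (exp (I * α) * (n : ℂ)).re ≤ 0 := by
  rw [← Complex.ofReal_natCast, Complex.re_mul_ofReal, exp_I_mul_re]
  exact mul_nonpos_of_nonpos_of_nonneg hα.le (Nat.cast_nonneg n)

theorem natCast_mem_borelHalfPlane (hα : Real.cos α < 0) (hA : 0 < A) (n : ℕ) :
    (n : ℂ) ∈ borelHalfPlane α A :=
  (natCast_re_nonpos hα n).trans_lt hA

theorem summable_exp_neg_mul (hα : Real.cos α < 0) (hA : 0 < A)
    (hu : IsSublinearOn (borelHalfPlane α A) u) {s : ℂ} (hs : 0 < s.re) :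
    Summable fun n : ℕ => exp (-(s * (n + u n))) := by
  obtain ⟨K, hK⟩ := hu.exists_exp_bound (norm_nonneg s) (half_pos hs)
  have hg : Summable fun n : ℕ => K * Real.exp (-(s.re / 2)) ^ n :=
    (summable_geometric_of_lt_one (Real.exp_pos _).le
      (Real.exp_lt_one_iff.2 (by linarith))).mul_left K
  refine Summable.of_norm_bounded hg fun n => ?_
  have h1 := hK s le_rfl n (natCast_mem_borelHalfPlane hα hA n)
  rw [Complex.norm_natCast] at h1
  rw [mul_add, neg_add, Complex.exp_add, norm_mul, Complex.norm_exp, ← Real.exp_nat_mul]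
  have h2 : (-(s * (n : ℂ))).re = -(s.re * n) := by simp
  rw [h2]
  calc _ ≤ Real.exp (-(s.re * n)) * (K * Real.exp (s.re / 2 * n)) := by gcongr
    _ = K * (Real.exp (-(s.re * n)) * Real.exp (s.re / 2 * n)) := by ring
    _ = _ := by rw [← Real.exp_add]; congr 2; ring

theorem hasSum_hankelTheta (hα : Real.cos α < 0)
    (hd : DifferentiableOn ℂ u (borelHalfPlane α A))
    (hu : IsSublinearOn (borelHalfPlane α A) u) (hC : C ∈ borelHalfPlane α A)
    (hC₀ : 0 < (exp (I * α) * C).re) {s : ℂ} (hs : 0 < s.re) (hsl : s ∈ thetaSlitPlane α) :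
    HasSum (fun n : ℕ => exp (-(s * (n + u n)))) (hankelTheta α C u s) := by
  obtain ⟨η₀, hη₀, b, hb, ρ, hρ, hstrip⟩ := exists_isPoleFreeStrip hα hsl
  have hp₀ : IsPoleFreeStrip α s η₀ := ⟨hη₀, b, hb, hstrip s (Metric.mem_ball_self hρ)⟩
  -- On this strip `Re ξ ≤ 2η ≤ Re s / 2`, so the geometric ratio `e^{ξ-s}` has modulus at most `q =
  -- e^{-Re s / 2} < 1`.
  set η := min η₀ (s.re / 4) with hη
  have hη0 : 0 < η := lt_min hη₀ (by positivity)
  have hηs : η ≤ s.re / 4 := min_le_right _ _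
  have hp : IsPoleFreeStrip α s η := hp₀.mono hη0 (min_le_left _ _)
  have hh : η / 2 ∈ Ioo 0 η := ⟨half_pos hη0, half_lt_self hη0⟩
  set q := Real.exp (-(s.re / 2)) with hq
  have hq1 : q < 1 := Real.exp_lt_one_iff.2 (by linarith)
  have hq0 : 0 ≤ q := (Real.exp_pos _).le
  have hE : ∀ z : ℂ, -η < z.re → |z.im| < η → ‖exp (exp (I * α) * z - s)‖ ≤ q := by
    intro z h1 h2
    rw [Complex.norm_exp]
    refine Real.exp_le_exp.2 ?_
    have h3 : |(exp (I * α)).im| ≤ 1 := (Complex.abs_im_le_norm _).trans (norm_exp_I_mul α).le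
    have h4 : -((exp (I * α)).im * z.im) ≤ η := by
      calc _ ≤ |(exp (I * α)).im * z.im| := neg_le_abs _
        _ = |(exp (I * α)).im| * |z.im| := abs_mul _ _
        _ ≤ 1 * η := mul_le_mul h3 h2.le (abs_nonneg _) zero_le_one
        _ = η := one_mul η
    rw [Complex.sub_re, Complex.mul_re, exp_I_mul_re]
    nlinarith [Real.neg_one_le_cos α]
  set F := thetaIntegrand α C u s with hF
  set E : ℕ → ℂ → ℂ := fun N ξ => exp (ξ - s) ^ N with hEdef
  have hEn : ∀ N, ∀ z : ℂ, -η < z.re → |z.im| < η → ‖E N (exp (I * α) * z)‖ ≤ q ^ N := by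
    intro N z h1 h2
    rw [hEdef, norm_pow]
    exact pow_le_pow_left₀ (norm_nonneg _) (hE z h1 h2) N
  have hFd := hasStripDecay_thetaIntegrand hd hu hC hC₀ hp
  have hFc := (differentiableOn_thetaIntegrand hd hu hC hp).continuousOn
  have hint : ∀ N, HankelIntegrable α (η / 2) (η / 2) fun ξ => E N ξ * F ξ := by
    intro N
    have hdec : HasStripDecay α η fun ξ => E N ξ * F ξ := by
      intro m hm
      obtain ⟨K, κ, hκ, hK⟩ := hFd m hm
      refine ⟨K, κ, hκ, fun z h1 h2 h3 => ?_⟩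
      rw [norm_mul]
      exact (mul_le_of_le_one_left (norm_nonneg _)
        ((hEn N z h1 h2).trans (pow_le_one₀ hq0 hq1.le))).trans (hK z h1 h2 h3)
    exact hdec.hankelIntegrable (ContinuousOn.mul (by fun_prop) hFc) hh hh
  -- One step of the finite geometric expansion: the factor `1 - e^{ξ-s}` cancels the denominator
  -- and inversion at `w = N` evaluates the term. Telescoping leaves a remainder of size `q ^ N`, so
  -- no infinite sum is interchanged with the integral.
  have hstep : ∀ N : ℕ, hankelIntegral α (η / 2) (η / 2) (fun ξ => E N ξ * F ξ) =
      exp (-(s * (N + u N))) +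
        hankelIntegral α (η / 2) (η / 2) (fun ξ => E (N + 1) ξ * F ξ) := by
    intro N
    obtain ⟨hi, hv⟩ := hankelIntegral_majorBorel_mul_exp hh hh (differentiableOn_exp_neg_mul hd s)
      (hu.isSubexpOn s) hC (w := N) ((natCast_re_nonpos hα N).trans_lt hC₀)
    have heq : EqOn (fun ξ => E N ξ * F ξ) (fun ξ => exp (-(s * N)) *
        (majorBorel α C (fun τ => exp (-(s * u τ))) ξ * exp (ξ * N)) + E (N + 1) ξ * F ξ)
        (slitStrip α η) := by
      intro ξ hξ
      have h1 : E N ξ = exp (-(s * N)) * exp (ξ * N) := by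
        simp only [hEdef]
        rw [← Complex.exp_add, ← Complex.exp_nat_mul]
        congr 1; ring
      have h2 : E (N + 1) ξ = E N ξ * exp (ξ - s) := pow_succ _ _
      have h3 : majorBorel α C (fun τ => exp (-(s * u τ))) ξ = F ξ * (1 - exp (ξ - s)) :=
        (div_mul_cancel₀ _ (hp.ne_zero hξ)).symm
      simp only [h2, h3]
      linear_combination F ξ * (1 - exp (ξ - s)) * h1
    rw [hankelIntegral_congr hh hh heq, hankelIntegral_add (hi.const_mul _) (hint (N + 1)),
      hankelIntegral_const_mul, hv, ← Complex.exp_add]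
    congr 2; ring
  have hpart : ∀ N : ℕ, ∑ n ∈ Finset.range N, exp (-(s * (n + u n))) =
      hankelTheta α C u s - hankelIntegral α (η / 2) (η / 2) (fun ξ => E N ξ * F ξ) := by
    intro N
    induction N with
    | zero =>
      rw [← hankelTheta_eq hd hu hC hC₀ hp hh hh]
      simp [hEdef, hF]
    | succ N ih => rw [Finset.sum_range_succ, ih, hstep N]; ring
  have hrem : Tendsto (fun N => hankelIntegral α (η / 2) (η / 2) (fun ξ => E N ξ * F ξ)) atTop
      (𝓝 0) := by
    refine squeeze_zero_norm (a := fun N => q ^ N * hankelNorm α (η / 2) (η / 2) F) (fun N => ?_) ?_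
    · refine norm_hankelIntegral_le hh hh (hankelIntegrable_thetaIntegrand hd hu hC hC₀ hp hh hh)
        fun ξ hξ => ?_
      obtain ⟨z, rfl⟩ : ∃ z, exp (I * α) * z = ξ := ⟨_, exp_I_mul_cancel_left α ξ⟩
      rw [exp_mul_mem_slitStrip_iff] at hξ
      rw [norm_mul]
      exact mul_le_mul_of_nonneg_right (hEn N z hξ.1.1 hξ.1.2) (norm_nonneg _)
    · simpa using (tendsto_pow_atTop_nhds_zero_of_lt_one hq0 hq1).mul_const
        (hankelNorm α (η / 2) (η / 2) F)
  have hA : 0 < A := hC₀.trans hC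
  have hsum := summable_exp_neg_mul hα hA hu hs
  have hlim : Tendsto (fun N : ℕ => ∑ n ∈ Finset.range N, exp (-(s * (n + u n)))) atTop
      (𝓝 (hankelTheta α C u s)) := by
    simp only [hpart]
    simpa using hrem.const_sub (hankelTheta α C u s)
  rw [← tendsto_nhds_unique hsum.hasSum.tendsto_sum_nat hlim]
  exact hsum.hasSum

/-- For each small `ε` the difference of the two line integrals is the Hankel integral, which is
constant in `ε`, minus the integral over the transverse side. The latter has length `2ε` and sits
behind the origin, where the integrand stays bounded. -/
theorem hasBVIntegral_hankelTheta (hd : DifferentiableOn ℂ u (borelHalfPlane α A))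
    (hu : IsSublinearOn (borelHalfPlane α A) u) (hC : C ∈ borelHalfPlane α A)
    (hC₀ : 0 < (exp (I * α) * C).re) {s : ℂ} {η δ : ℝ} (hp : IsPoleFreeStrip α s η)
    (hδ : δ ∈ Ioo 0 η) :
    HasBVIntegral α δ (fun ξ => 1 / (1 - exp (ξ - s)))
      (fun ξ => majorBorel α C (fun τ => exp (-(s * u τ))) ξ) (hankelTheta α C u s) := by
  set F := thetaIntegrand α C u s with hF
  have hη := hp.1
  have hFc := (differentiableOn_thetaIntegrand hd hu hC hp).continuousOn
  have hcont : ContinuousOn (fun y : ℝ => F (exp (I * α) * (-δ + I * y)) * (exp (I * α) * I))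
      (Icc (-(η / 2)) (η / 2)) :=
    ContinuousOn.mul (hFc.comp (by fun_prop) fun y hy =>
      left_mem_slitStrip hδ ⟨half_pos hη, half_lt_self hη⟩ hy) continuousOn_const
  obtain ⟨M, hM⟩ := isCompact_Icc.exists_bound_of_continuousOn hcont
  have hcross : Tendsto (fun ε : ℝ => ∫ y : ℝ in ε..(-ε),
      F (exp (I * α) * (-δ + I * y)) * (exp (I * α) * I)) (𝓝[>] 0) (𝓝 0) := by
    refine squeeze_zero_norm' (a := fun ε => M * |-ε - ε|) ?_ ?_
    · filter_upwards [Ioo_mem_nhdsGT (half_pos hη)] with ε hε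
      refine intervalIntegral.norm_integral_le_of_norm_le_const fun y hy => hM y ?_
      have := uIoc_subset_uIcc hy
      rw [uIcc_neg_self hε.1] at this
      exact ⟨by linarith [this.1, hε.2], by linarith [this.2, hε.2]⟩
    · have : Continuous fun ε : ℝ => M * |-ε - ε| := by fun_prop
      simpa using (this.tendsto 0).mono_left nhdsWithin_le_nhds
  have hmain := hcross.const_sub (hankelTheta α C u s)
  rw [sub_zero] at hmain
  refine hmain.congr' ?_
  filter_upwards [Ioo_mem_nhdsGT hη] with ε hε
  rw [← hankelTheta_eq hd hu hC hC₀ hp hδ hε, hankelIntegral, ← hF]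
  have hG : ∀ ξ, 1 / (1 - exp (ξ - s)) * majorBorel α C (fun τ => exp (-(s * u τ))) ξ = F ξ := by
    intro ξ
    rw [hF, thetaIntegrand, one_div_mul_eq_div]
  simp only [hG]
  ring

end

/-! ### Sublinearity of `u`, and the orbit in the Fatou coordinate. -/

section fatou

theorem exists_pow_le_mul_pow_add {j k : ℕ} (hjk : j < k) {ε : ℝ} (hε : 0 < ε) :
    ∃ K : ℝ, ∀ y : ℝ, 0 ≤ y → y ^ j ≤ ε * y ^ k + K := by
  set Y := max 1 (1 / ε) with hY
  refine ⟨Y ^ j, fun y hy => ?_⟩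
  rcases le_total y Y with h | h
  · have := pow_le_pow_left₀ hy h j
    have : 0 ≤ ε * y ^ k := by positivity
    linarith
  · have h1 : 1 ≤ y := (le_max_left _ _).trans h
    have h2 : 1 ≤ ε * y := by
      have := (le_max_right 1 (1 / ε)).trans h
      rw [div_le_iff₀ hε] at this
      linarith
    have h3 : y ^ (j + 1) ≤ y ^ k := pow_le_pow_right₀ h1 hjk
    have h4 : y ^ j ≤ ε * y ^ (j + 1) := by
      rw [pow_succ]
      nlinarith [pow_nonneg hy j]
    have h5 : 0 ≤ Y ^ j := by positivity
    nlinarith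

/-- `log (ε‖T‖) ≤ ε‖T‖` handles large `‖T‖`, and the lower bound `T₀` excludes the singularity at
`0`. The argument contributes at most `π`. -/
theorem exists_norm_log_le {T₀ : ℝ} (hT₀ : 0 < T₀) {ε : ℝ} (hε : 0 < ε) :
    ∃ K : ℝ, ∀ T : ℂ, T₀ ≤ ‖T‖ → ‖log T‖ ≤ ε * ‖T‖ + K := by
  refine ⟨|Real.log ε| + |Real.log T₀| + Real.pi, fun T hT => ?_⟩
  have hT0 : 0 < ‖T‖ := hT₀.trans_le hT
  have h1 : |Real.log ‖T‖| ≤ ε * ‖T‖ + |Real.log ε| + |Real.log T₀| := by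
    have h2 : Real.log (ε * ‖T‖) ≤ ε * ‖T‖ :=
      (Real.log_le_sub_one_of_pos (by positivity)).trans (by linarith)
    rw [Real.log_mul hε.ne' hT0.ne'] at h2
    have h3 := Real.log_le_log hT₀ hT
    have h4 : 0 < ε * ‖T‖ := by positivity
    rw [abs_le]
    constructor
    · linarith [neg_abs_le (Real.log T₀), abs_nonneg (Real.log ε)]
    · linarith [neg_abs_le (Real.log ε), abs_nonneg (Real.log T₀)]
  calc ‖log T‖ ≤ |(log T).re| + |(log T).im| := Complex.norm_le_abs_re_add_abs_im _
    _ ≤ (ε * ‖T‖ + |Real.log ε| + |Real.log T₀|) + Real.pi := by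
      rw [Complex.log_re, Complex.log_im]
      exact add_le_add h1 (Complex.abs_arg_le_pi T)
    _ = _ := by ring

variable {f : ℂ → ℂ} {a : ℂ} {k : ℕ} {R : ℝ} {W : Set ℂ} {ψ : ℂ → ℂ}

theorem IsSectorialFatou.ne_zero (hf : IsParabolicGerm f a k R)
    (hψ : IsSectorialFatou f a k R W ψ) {x : ℂ} (hx : x ∈ W) : x ≠ 0 := by
  rintro rfl
  have := hψ.arg_lt 0 hx
  have hk : k ≠ 0 := by have := hf.k_pos; omega
  simp [modelFatou, hk] at this

theorem norm_modelFatou (a : ℂ) (k : ℕ) (x : ℂ) :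
    ‖modelFatou a k x‖ = ‖x⁻¹‖ ^ k / (‖a‖ * k) := by
  rw [modelFatou, norm_div, norm_neg, norm_one, norm_mul, norm_mul, Complex.norm_natCast, norm_pow,
    norm_inv, inv_pow]
  simp only [mul_inv, div_eq_mul_inv]
  ring

/-- A sectorial Fatou coordinate differs from the model Fatou coordinate by a sublinear term. -/
theorem IsSectorialFatou.exists_norm_sub_le (hf : IsParabolicGerm f a k R)
    (hψ : IsSectorialFatou f a k R W ψ) {ε : ℝ} (hε : 0 < ε) :
    ∃ K : ℝ, ∀ x ∈ W, ‖ψ x - modelFatou a k x‖ ≤ ε * ‖modelFatou a k x‖ + K := by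
  obtain ⟨r, ρ, M, hM⟩ := hψ.asymptotic
  have hk : 0 < k := hf.k_pos
  have hk' : (0 : ℝ) < k := by exact_mod_cast hk
  have ha : 0 < ‖a‖ := norm_pos_iff.2 hf.a_ne
  -- Lower bound of `‖t(x)‖` on the disc of radius `R`.
  set T₀ := (R⁻¹) ^ k / (‖a‖ * k) with hT₀
  have hT₀pos : 0 < T₀ := by have := hf.R_pos; positivity
  obtain ⟨L, hL⟩ := exists_norm_log_le hT₀pos (ε := ε / 2 / (‖(ρ / k : ℂ)‖ + 1)) (by positivity)
  have hj : ∀ j ∈ Finset.Ico 1 k, ∃ K : ℝ, ∀ x ∈ W,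
      ‖r j / x ^ j‖ ≤ ε / 2 / k * ‖modelFatou a k x‖ + K := by
    intro j hj
    -- Each of the fewer than `k` terms `r j / x ^ j` gets a share `ε / 2 / k` of the slope, the
    -- logarithm the other `ε / 2`; the `+ 1` in the denominators allows zero coefficients.
    obtain ⟨K, hK⟩ := exists_pow_le_mul_pow_add (Finset.mem_Ico.1 hj).2
      (ε := ε / 2 / k / (‖a‖ * k) / (‖r j‖ + 1)) (by positivity)
    refine ⟨‖r j‖ * K, fun x hx => ?_⟩
    have h1 := hK ‖x⁻¹‖ (norm_nonneg _)
    rw [div_eq_mul_inv, ← inv_pow, norm_mul, norm_pow, norm_modelFatou]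
    calc _ ≤ ‖r j‖ * (ε / 2 / k / (‖a‖ * k) / (‖r j‖ + 1) * ‖x⁻¹‖ ^ k + K) := by gcongr
      _ = ‖r j‖ / (‖r j‖ + 1) * (ε / 2 / k * (‖x⁻¹‖ ^ k / (‖a‖ * k))) + ‖r j‖ * K := by ring
      _ ≤ _ := by
        refine add_le_add (mul_le_of_le_one_left (by positivity) ?_) le_rfl
        rw [div_le_one (by positivity)]
        linarith
  choose! Kj hKj using hj
  refine ⟨M + ∑ j ∈ Finset.Ico 1 k, Kj j + ‖(ρ / k : ℂ)‖ * L, fun x hx => ?_⟩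
  set T := modelFatou a k x with hT
  have hx0 := hψ.ne_zero hf hx
  have hxR : ‖x‖ < R := by simpa using hψ.subset_ball hx
  have hTT₀ : T₀ ≤ ‖T‖ := by
    rw [hT, norm_modelFatou, hT₀, norm_inv]
    have := hf.R_pos
    have hxp : 0 < ‖x‖ := norm_pos_iff.2 hx0
    gcongr
  have h1 := hM x hx
  have h2 : ‖∑ j ∈ Finset.Ico 1 k, r j / x ^ j‖ ≤ ε / 2 * ‖T‖ + ∑ j ∈ Finset.Ico 1 k, Kj j := by
    refine (norm_sum_le _ _).trans ((Finset.sum_le_sum fun j hj => hKj j hj x hx).trans ?_)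
    rw [Finset.sum_add_distrib, Finset.sum_const, Nat.card_Ico, nsmul_eq_mul]
    have h3 : ((k - 1 : ℕ) : ℝ) ≤ k := by exact_mod_cast Nat.sub_le k 1
    have h4 : ((k - 1 : ℕ) : ℝ) * (ε / 2 / k * ‖T‖) ≤ k * (ε / 2 / k * ‖T‖) := by gcongr
    have h5 : k * (ε / 2 / k * ‖T‖) = ε / 2 * ‖T‖ := by field_simp
    linarith
  have h3 : ‖(ρ / k : ℂ) * log T‖ ≤ ε / 2 * ‖T‖ + ‖(ρ / k : ℂ)‖ * L := by
    rw [norm_mul]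
    calc _ ≤ ‖(ρ / k : ℂ)‖ * (ε / 2 / (‖(ρ / k : ℂ)‖ + 1) * ‖T‖ + L) := by
          gcongr; exact hL T hTT₀
      _ = ‖(ρ / k : ℂ)‖ / (‖(ρ / k : ℂ)‖ + 1) * (ε / 2 * ‖T‖) + ‖(ρ / k : ℂ)‖ * L := by ring
      _ ≤ _ := by
        refine add_le_add (mul_le_of_le_one_left (by positivity) ?_) le_rfl
        rw [div_le_one (by positivity)]
        linarith
  have h4 : ψ x - T = (ψ x - (T + ∑ j ∈ Finset.Ico 1 k, r j / x ^ j - ρ / k * log T)) +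
      ∑ j ∈ Finset.Ico 1 k, r j / x ^ j - ρ / k * log T := by ring
  rw [h4]
  refine (norm_sub_le _ _).trans ((add_le_add ((norm_add_le _ _).trans (add_le_add h1 h2))
    h3).trans_eq ?_)
  ring

theorem isSublinearOn_uFun (hf : IsParabolicGerm f a k R) (hψ : IsSectorialFatou f a k R W ψ)
    {P : Set ℂ} (hP : P ⊆ ψ '' W) : IsSublinearOn P (uFun a k W ψ) := by
  intro ε hε
  -- The known bound is in terms of `‖T‖ ≤ ‖T - τ‖ + ‖τ‖`. Slope at most `1 / 2` lets `‖T - τ‖` be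
  -- absorbed on the left, which doubles the rest; hence `ε / 2` and the constant `2 * K`.
  obtain ⟨K, hK⟩ := hψ.exists_norm_sub_le hf (ε := min (1 / 2) (ε / 2)) (by positivity)
  refine ⟨2 * K, fun τ hτ => ?_⟩
  have hx := Function.invFunOn_mem (hP hτ)
  have hxτ := Function.invFunOn_eq (hP hτ)
  have h1 := hK _ hx
  rw [hxτ] at h1
  rw [uFun]
  set T := modelFatou a k (Function.invFunOn ψ W τ)
  rw [norm_sub_rev] at h1
  have h2 : ‖T‖ ≤ ‖T - τ‖ + ‖τ‖ := by
    calc ‖T‖ = ‖(T - τ) + τ‖ := by rw [sub_add_cancel]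
      _ ≤ _ := norm_add_le _ _
  set e := min (1 / 2) (ε / 2)
  have he1 : e ≤ 1 / 2 := min_le_left _ _
  have he2 : e ≤ ε / 2 := min_le_right _ _
  have he0 : 0 < e := lt_min (by norm_num) (half_pos hε)
  have h3 : e * ‖T‖ ≤ e * ‖T - τ‖ + e * ‖τ‖ := by rw [← mul_add]; gcongr
  have h4 : e * ‖T - τ‖ ≤ 1 / 2 * ‖T - τ‖ := by gcongr
  have h5 : e * ‖τ‖ ≤ ε / 2 * ‖τ‖ := by gcongr
  linarith

theorem differentiableOn_uFun (hf : IsParabolicGerm f a k R)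
    (hψ : IsSectorialFatou f a k R W ψ) {P : Set ℂ} (hP : P ⊆ ψ '' W) :
    DifferentiableOn ℂ (uFun a k W ψ) P := by
  have h1 := (hψ.injOn.differentiableOn_invFunOn hψ.isOpen hψ.holo).mono hP
  unfold uFun modelFatou
  refine DifferentiableOn.sub (DifferentiableOn.div (differentiableOn_const _)
    ((h1.pow k).const_mul _) fun τ hτ => ?_) differentiableOn_id
  have hx := hψ.ne_zero hf (Function.invFunOn_mem (hP hτ))
  have hk : k ≠ 0 := by have := hf.k_pos; omega
  have := hf.a_ne
  positivity

/-- By the Abel equation and the normalisation at `x₀`, the orbit sits at the integers `n` in the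
Fatou coordinate. These are the points at which the inversion formula is used. -/
theorem modelFatou_iterate (hψ : IsSectorialFatou f a k R W ψ) {x₀ : ℂ} (hx₀ : x₀ ∈ W)
    (hψ₀ : ψ x₀ = 0) (n : ℕ) : modelFatou a k (f^[n] x₀) = n + uFun a k W ψ n := by
  have h : f^[n] x₀ ∈ W ∧ ψ (f^[n] x₀) = n := by
    induction n with
    | zero => exact ⟨hx₀, by simpa using hψ₀⟩
    | succ n ih =>
      rw [Function.iterate_succ_apply']
      exact ⟨hψ.mapsTo ih.1, by rw [hψ.abel _ ih.1, ih.2]; push_cast; ring⟩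
  rw [uFun, ← h.2, hψ.injOn.leftInvOn_invFunOn h.1]
  ring

end fatou

/-! ### The main theorem. -/

/-- All slits start on the imaginary axis and run into the left half-plane because `cos α < 0`. -/
theorem mem_thetaSlitPlane_of_re_pos {α : ℝ} (hα : Real.cos α < 0) {s : ℂ} (hs : 0 < s.re) :
    s ∈ thetaSlitPlane α := by
  intro n r hr h
  have h1 : s.re = Real.cos α * r := by
    rw [h, Complex.add_re, Complex.re_mul_ofReal, exp_I_mul_re]
    simp
  nlinarith

theorem mainTheorem8
    (f : ℂ → ℂ) (a : ℂ) (k : ℕ) (R : ℝ) (hf : IsParabolicGerm f a k R)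
    (W : Set ℂ) (ψ : ℂ → ℂ) (hψ : IsSectorialFatou f a k R W ψ)
    (x₀ : ℂ) (hx₀ : x₀ ∈ W) (hψ₀ : ψ x₀ = 0)
    (α : ℝ) (hα : ∃ m : ℤ, α - 2 * Real.pi * m ∈ Set.Ioo (Real.pi / 2) (3 * Real.pi / 2))
    (A : ℝ) (hA : borelHalfPlane α A ⊆ ψ '' W)
    (C : ℂ) (hC₀ : 0 < (Complex.exp (Complex.I * α) * C).re)
    (hCA : C ∈ borelHalfPlane α A) :
    ∃ (Θ : ℂ → ℂ) (Qt : ℂ → ℂ → ℂ),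
      IsDynamicTheta f a k x₀ α Θ ∧
      (∀ σ : ℂ, IsMajorBorel α C (fun τ => Complex.exp (-(σ * uFun a k W ψ τ)))
        (fun ξ => Qt ξ σ)) ∧
      ∀ s ∈ thetaSlitPlane α, ∃ η : ℝ, 0 < η ∧ ∀ δ ∈ Set.Ioo 0 η,
        (∀ ε ∈ Set.Ioo 0 η,
          HankelIntegrable α δ ε (fun ξ => Qt ξ s / (1 - Complex.exp (ξ - s))) ∧
          hankelIntegral α δ ε (fun ξ => Qt ξ s / (1 - Complex.exp (ξ - s))) = Θ s) ∧
        HasBVIntegral α δ (fun ξ => 1 / (1 - Complex.exp (ξ - s))) (fun ξ => Qt ξ s) (Θ s) := by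
  
  have hcos : Real.cos α < 0 := by
    obtain ⟨m, hm⟩ := hα
    rw [← Real.cos_sub_int_mul_two_pi α m, mul_comm (m : ℝ)]
    exact Real.cos_neg_of_pi_div_two_lt_of_lt hm.1 (by linarith [hm.2])
  have hd := differentiableOn_uFun hf hψ hA
  have hu := isSublinearOn_uFun hf hψ hA
  refine ⟨hankelTheta α C (uFun a k W ψ),
    fun ξ σ => majorBorel α C (fun τ => exp (-(σ * uFun a k W ψ τ))) ξ,
    ⟨differentiableOn_hankelTheta hcos hd hu hCA hC₀, fun s hs => ?_⟩, fun σ =>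
    isMajorBorel_majorBorel (differentiableOn_exp_neg_mul hd σ) (hu.isSubexpOn σ) hCA,
    fun s hs => ?_⟩
  · simp only [modelFatou_iterate hψ hx₀ hψ₀]
    exact hasSum_hankelTheta hcos hd hu hCA hC₀ hs (mem_thetaSlitPlane_of_re_pos hcos hs)
  · obtain ⟨η, hη, b, hb, ρ, hρ, hstrip⟩ := exists_isPoleFreeStrip hcos hs
    have hp : IsPoleFreeStrip α s η := ⟨hη, b, hb, hstrip s (Metric.mem_ball_self hρ)⟩
    exact ⟨η, hη, fun δ hδ => ⟨fun ε hε => ⟨hankelIntegrable_thetaIntegrand hd hu hCA hC₀ hp hδ hε,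
      hankelTheta_eq hd hu hCA hC₀ hp hδ hε⟩, hasBVIntegral_hankelTheta hd hu hCA hC₀ hp hδ⟩⟩
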